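/- Let $x_1,\dots,x_m\in\mathbb R^3$ be distinct points and let $H$ be the minimal Schrödinger operator in $L^2(\mathbb R^3)$, $$H=-\Delta,\qquad \operatorname{dom}(H)=\{f\in W^{2,2}(\mathbb R^3): f(x_j)=0,\ j=1,\dots,m\}.$$ Then $H$ is densely defined. For $f\in\operatorname{dom}(H^*)$ (taken with its representative that is continuous on $\mathbb R^3\setminus\{x_1,\dots,x_m\}$) the limits $$\xi_{0j}=\lim_{x\to x_j}f(x)|x-x_j|,\qquad \Gamma_0f=4\pi\{\xi_{0j}\}_{j=1}^m,\qquad \Gamma_1f=\Bigl\{\lim_{x\to x_j}\Bigl(f(x)-\frac{\xi_{0j}}{|x-x_j|}\Bigr)\Bigr\}_{j=1}^m$$ exist and define a boundary triplet $\Pi=\{\mathbb C^m,\Gamma_0,\Gamma_1\}$ for $H^*$, that is, $\Gamma_0,\Gamma_1:\operatorname{dom}(H^*)\to\mathbb C^m$ are linear, $(H^*f,g)-(f,H^*g)=(\Gamma_1f,\Gamma_0g)-(\Gamma_0f,\Gamma_1g)$ for all $f,g\in\operatorname{dom}(H^*)$, and $f\mapsto(\Gamma_0f,\Gamma_1f)$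 maps $\operatorname{dom}(H^*)$ onto $\mathbb C^m\oplus\mathbb C^m$. Put $H_0=H^*\upharpoonright\ker\Gamma_0$ and $\mathfrak N_z=\ker(H^*-z)$. There are exactly one Weyl function, i.e. a function $M$ from the resolvent set $\rho(H_0)$ to the linear operators on $\mathbb C^m$ with $M(z)\Gamma_0f=\Gamma_1f$ for all $f\in\mathfrak N_z$, and exactly one $\gamma$-field, i.e. $\gamma(z)=(\Gamma_0\upharpoonright\mathfrak N_z)^{-1}:\mathbb C^m\to\mathfrak N_z$ for $z\in\rho(H_0)$. Moreover $\mathbb C\setminus[0,\infty)\subset\rho(H_0)$, and for every $z\in\mathbb C\setminus[0,\infty)$, with $\sqrt z$ the square root with $\operatorname{Im}\sqrt z>0$: (i) $$M(z)=\Bigl(\frac{i\sqrt z}{4\pi}\,\delta_{jk}+\widetilde G_{\sqrt z}(x_j-x_k)\Bigr)_{j,k=1}^m,\qquad \widetilde G_{\sqrt z}(x)=\begin{cases}\dfrac{e^{i\sqrt z|x|}}{4\pi|x|},&x\ne0,\\[2mm]0,&x=0;\end{cases}$$ (ii) for all $(a_j)_{j=1}^m\in\mathbb C^m$, $$\gamma(z)\{a_j\}_{j=1}^m=\sum_{j=1}^m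 a_j\,\frac{e^{i\sqrt z\,r_j}}{4\pi r_j},\qquad r_j(x)=|x-x_j|.$$ -/

import Mathlib

noncomputable section

namespace PointInteraction

open MeasureTheory Filter Topology LineDeriv
open scoped LineDeriv Laplacian SchwartzMap

section AbstractTriplets

variable {V : Type*} [NormedAddCommGroup V] [InnerProductSpace ℂ V]

/-- The resolvent set of a (possibly unbounded) operator `T`: those `z` for which `T - z` maps
the domain of `T` bijectively onto the whole space, with bounded inverse `R`. -/
def resolventSet (T : V →ₗ.[ℂ] V) : Set ℂ :=
  {z | ∃ R : V →L[ℂ] V,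
    (∀ y : V, ∃ h : R y ∈ T.domain, T ⟨R y, h⟩ - z • R y = y) ∧
    ∀ u : T.domain, R (T u - z • (u : V)) = u}

variable [CompleteSpace V]

/-- The defect subspace `𝔑_z = ker (A* - z)`. -/
def defectSubspace (A : V →ₗ.[ℂ] V) (z : ℂ) : Set V :=
  {f | ∃ h : f ∈ A.adjoint.domain, A.adjoint ⟨f, h⟩ = z • f}

/-- A boundary triplet `{K, Γ₀, Γ₁}` for the adjoint `A*` of `A`. Mathlib's inner product is
conjugate linear in the first variable, so the inner product `(u, v)` that is linear in the first
variable is `inner ℂ v u`. -/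
@[ext]
structure BoundaryTriplet (A : V →ₗ.[ℂ] V) (K : Type*) [NormedAddCommGroup K]
    [InnerProductSpace ℂ K] where
  /-- the boundary map `Γ₀ : dom A* → K` -/
  Γ₀ : A.adjoint.domain →ₗ[ℂ] K
  /-- the boundary map `Γ₁ : dom A* → K` -/
  Γ₁ : A.adjoint.domain →ₗ[ℂ] K
  /-- `(A* f, g) - (f, A* g) = (Γ₁ f, Γ₀ g) - (Γ₀ f, Γ₁ g)` -/
  green : ∀ f g : A.adjoint.domain,
    inner ℂ (g : V) (A.adjoint f) - inner ℂ (A.adjoint g) (f : V) =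
      inner ℂ (Γ₀ g) (Γ₁ f) - inner ℂ (Γ₁ g) (Γ₀ f)
  /-- `(Γ₀, Γ₁) : dom A* → K ⊕ K` is onto -/
  surjective : ∀ a b : K, ∃ f : A.adjoint.domain, Γ₀ f = a ∧ Γ₁ f = b

namespace BoundaryTriplet

variable {A : V →ₗ.[ℂ] V} {K : Type*} [NormedAddCommGroup K] [InnerProductSpace ℂ K]

/-- The extension `A₀`, the restriction of `A*` to `ker Γ₀`. -/
def A₀ (P : BoundaryTriplet A K) : V →ₗ.[ℂ] V :=
  A.adjoint.domRestrict ((LinearMap.ker P.Γ₀).map A.adjoint.domain.subtype)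

/-- `M : ρ(A₀) → [K]` is the Weyl function of the triplet: `M(z) Γ₀ f = Γ₁ f` for `f ∈ 𝔑_z`. -/
def IsWeylFunction (P : BoundaryTriplet A K) (M : resolventSet P.A₀ → (K →L[ℂ] K)) : Prop :=
  ∀ (z : resolventSet P.A₀) (f : A.adjoint.domain),
    (f : V) ∈ defectSubspace A z → M z (P.Γ₀ f) = P.Γ₁ f

/-- `γ : ρ(A₀) → [K, V]` is the `γ`-field of the triplet: `γ(z)` is the inverse of the
restriction of `Γ₀` to `𝔑_z`. -/
def IsGammaField (P : BoundaryTriplet A K) (γ : resolventSet P.A₀ → (K →L[ℂ] V)) : Prop :=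
  ∀ z : resolventSet P.A₀,
    (∀ a : K, γ z a ∈ defectSubspace A z ∧
      ∃ h : γ z a ∈ A.adjoint.domain, P.Γ₀ ⟨γ z a, h⟩ = a) ∧
    ∀ f : A.adjoint.domain, (f : V) ∈ defectSubspace A z → γ z (P.Γ₀ f) = f

end BoundaryTriplet

end AbstractTriplets

section Schroedinger

/-- `ℝ³` -/
abbrev E3 : Type := EuclideanSpace ℝ (Fin 3)

/-- `L²(ℝ³)` -/
abbrev L2 : Type := Lp ℂ 2 (volume : Measure E3)

/-- The tempered distribution `u` is (given by) an element of `L²(ℝ³)`. -/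
def InL2 (u : 𝓢'(E3, ℂ)) : Prop := ∃ g : L2, u = (g : 𝓢'(E3, ℂ))

lemma coe_add_dist (f g : L2) :
    ((f + g : L2) : 𝓢'(E3, ℂ)) = (f : 𝓢'(E3, ℂ)) + (g : 𝓢'(E3, ℂ)) := by
  simp only [← Lp.toTemperedDistributionCLM_apply, map_add]

lemma coe_smul_dist (c : ℂ) (f : L2) :
    ((c • f : L2) : 𝓢'(E3, ℂ)) = c • (f : 𝓢'(E3, ℂ)) := by
  simp only [← Lp.toTemperedDistributionCLM_apply, map_smul]

lemma coe_zero_dist : ((0 : L2) : 𝓢'(E3, ℂ)) = 0 := by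
  simp only [← Lp.toTemperedDistributionCLM_apply, map_zero]

lemma coe_dist_injective {f g : L2} (h : (f : 𝓢'(E3, ℂ)) = (g : 𝓢'(E3, ℂ))) : f = g := by
  have := LinearMap.ker_eq_bot.1
    (Lp.ker_toTemperedDistributionCLM_eq_bot (F := ℂ) (p := 2) (μ := (volume : Measure E3)))
  exact this h

lemma InL2.zero : InL2 0 := ⟨0, coe_zero_dist.symm⟩

lemma InL2.add {u v : 𝓢'(E3, ℂ)} (hu : InL2 u) (hv : InL2 v) : InL2 (u + v) := by
  obtain ⟨f, rfl⟩ := hu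
  obtain ⟨g, rfl⟩ := hv
  exact ⟨f + g, (coe_add_dist f g).symm⟩

lemma InL2.smul (c : ℂ) {u : 𝓢'(E3, ℂ)} (hu : InL2 u) : InL2 (c • u) := by
  obtain ⟨f, rfl⟩ := hu
  exact ⟨c • f, (coe_smul_dist c f).symm⟩

/-- The Sobolev space `W^{2,2}(ℝ³)`: the `f ∈ L²` all of whose distributional derivatives of
order one and two belong to `L²`. -/
def W22 : Submodule ℂ L2 where
  carrier := {f | (∀ v : E3, InL2 (∂_{v} (f : 𝓢'(E3, ℂ)))) ∧
    ∀ v w : E3, InL2 (∂_{v} (∂_{w} (f : 𝓢'(E3, ℂ))))}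
  zero_mem' := by
    simp only [Set.mem_ofPred_eq, coe_zero_dist, lineDerivOp_zero]
    exact ⟨fun _ => InL2.zero, fun _ _ => InL2.zero⟩
  add_mem' := by
    intro f g hf hg
    simp only [Set.mem_ofPred_eq, coe_add_dist, lineDerivOp_add]
    exact ⟨fun v => (hf.1 v).add (hg.1 v), fun v w => (hf.2 v w).add (hg.2 v w)⟩
  smul_mem' := by
    intro c f hf
    simp only [Set.mem_ofPred_eq, coe_smul_dist, lineDerivOp_smul]
    exact ⟨fun v => (hf.1 v).smul c, fun v w => (hf.2 v w).smul c⟩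

lemma inL2_laplacian {f : L2} (hf : f ∈ W22) : InL2 (Δ (f : 𝓢'(E3, ℂ))) := by
  rw [TemperedDistribution.laplacian_eq_sum (EuclideanSpace.basisFun (Fin 3) ℝ)]
  exact Finset.sum_induction _ InL2 (fun _ _ => InL2.add) InL2.zero fun i _ => hf.2 _ _

/-- The functions of `W^{2,2}(ℝ³)` that vanish at the points `x_j`; the value at a point is that
of the continuous representative. -/
def minimalDomain {m : ℕ} (x : Fin m → E3) : Submodule ℂ L2 where
  carrier := {f | f ∈ W22 ∧ ∃ g : E3 → ℂ, Continuous g ∧ f =ᵐ[volume] g ∧ ∀ j, g (x j) = 0}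
  zero_mem' := ⟨W22.zero_mem, 0, continuous_zero, Lp.coeFn_zero _ _ _, fun _ => rfl⟩
  add_mem' := by
    rintro f f' ⟨hf, g, hg, hfg, hg0⟩ ⟨hf', g', hg', hfg', hg0'⟩
    refine ⟨W22.add_mem hf hf', g + g', hg.add hg', ?_, fun j => by simp [hg0, hg0']⟩
    filter_upwards [Lp.coeFn_add f f', hfg, hfg'] with y h1 h2 h3
    rw [Pi.add_apply, ← h2, ← h3]
    exact h1
  smul_mem' := by
    rintro c f ⟨hf, g, hg, hfg, hg0⟩
    refine ⟨W22.smul_mem c hf, c • g, hg.const_smul c, ?_, fun j => by simp [hg0]⟩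
    filter_upwards [Lp.coeFn_smul c f, hfg] with y h1 h2
    rw [Pi.smul_apply, ← h2]
    exact h1

/-- The minimal Schrödinger operator `H = -Δ` on `minimalDomain x`: `H f` is the element of
`L²(ℝ³)` that represents the distribution `-Δ f`. -/
def minimalH {m : ℕ} (x : Fin m → E3) : L2 →ₗ.[ℂ] L2 where
  domain := minimalDomain x
  toFun :=
    { toFun := fun f => -(inL2_laplacian f.2.1).choose
      map_add' := by
        intro f g
        apply coe_dist_injective
        have h1 := (inL2_laplacian f.2.1).choose_spec
        have h2 := (inL2_laplacian g.2.1).choose_spec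
        have h3 := (inL2_laplacian (f + g).2.1).choose_spec
        rw [← neg_add]
        congr 2
        apply coe_dist_injective
        rw [coe_add_dist, ← h1, ← h2, ← h3, Submodule.coe_add, coe_add_dist, ← TemperedDistribution.laplacianCLM_apply,
          map_add, TemperedDistribution.laplacianCLM_apply,
          TemperedDistribution.laplacianCLM_apply]
      map_smul' := by
        intro c f
        have h1 := (inL2_laplacian f.2.1).choose_spec
        have h3 := (inL2_laplacian (c • f).2.1).choose_spec
        rw [RingHom.id_apply, smul_neg]
        congr 1
        apply coe_dist_injective
        rw [coe_smul_dist, ← h1, ← h3, Submodule.coe_smul, coe_smul_dist, ← TemperedDistribution.laplacianCLM_apply,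
          map_smul, TemperedDistribution.laplacianCLM_apply] }

/-- `H f = -Δ f` in the sense of distributions. -/
lemma minimalH_spec {m : ℕ} (x : Fin m → E3) (f : (minimalH x).domain) :
    ((-(minimalH x f) : L2) : 𝓢'(E3, ℂ)) = Δ ((f : L2) : 𝓢'(E3, ℂ)) := by
  have h : minimalH x f = -(inL2_laplacian f.2.1).choose := rfl
  rw [h, neg_neg]
  exact (inL2_laplacian f.2.1).choose_spec.symm

/-- The boundary maps of the triplet `P` are the ones of the point interaction problem:
`Γ₀ f = 4π {ξ_j}` with `ξ_j = lim_{y → x_j} f(y) |y - x_j|`, and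
`Γ₁ f = {lim_{y → x_j} (f(y) - ξ_j / |y - x_j|)}`. Here the values of `f ∈ L²` are those of its
representative that is continuous off the points `x_j`. -/
def HasPointBoundaryMaps {m : ℕ} (x : Fin m → E3)
    (P : BoundaryTriplet (minimalH x) (EuclideanSpace ℂ (Fin m))) : Prop :=
  ∀ f : (minimalH x).adjoint.domain, ∃ g : E3 → ℂ,
    ContinuousOn g (Set.range x)ᶜ ∧ (f : L2) =ᵐ[volume] g ∧
    ∀ j : Fin m, ∃ ξ : ℂ,
      Tendsto (fun y : E3 => g y * (‖y - x j‖ : ℂ)) (𝓝[≠] (x j)) (𝓝 ξ) ∧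
      P.Γ₀ f j = 4 * (Real.pi : ℂ) * ξ ∧
      Tendsto (fun y : E3 => g y - ξ / (‖y - x j‖ : ℂ)) (𝓝[≠] (x j)) (𝓝 (P.Γ₁ f j))

/-- The branch of the square root on `ℂ ∖ ℝ₊` with positive imaginary part. On the upper side of
the cut it has the boundary value `√1 = 1`. (`z ^ (1 / 2)` is the principal branch.) -/
def sqrtBranch (z : ℂ) : ℂ :=
  if 0 ≤ z.im then z ^ (1 / 2 : ℂ) else -z ^ (1 / 2 : ℂ)

/-- `e^{i √z |x|} / (4π |x|)` -/
def green (z : ℂ) (x : E3) : ℂ :=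
  Complex.exp (Complex.I * sqrtBranch z * (‖x‖ : ℂ)) / (4 * (Real.pi : ℂ) * (‖x‖ : ℂ))

/-- The function `e^{i √z |x|} / (4π |x|)` for `x ≠ 0`, and `0` for `x = 0`. -/
def greenTilde (z : ℂ) (x : E3) : ℂ :=
  if x = 0 then 0 else green z x

/-- The matrix `((i √z / 4π) δ_{jk} + G̃_{√z}(x_j - x_k))_{j,k}`. -/
def weylMatrix {m : ℕ} (x : Fin m → E3) (z : ℂ) : Matrix (Fin m) (Fin m) ℂ :=
  Matrix.of fun j k =>
    Complex.I * sqrtBranch z / (4 * (Real.pi : ℂ)) * (if j = k then 1 else 0) +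
      greenTilde z (x j - x k)

end Schroedinger

end PointInteraction

end

/-!
The proof rests on the Krein resolvent picture of point interactions. Write
`G_z(y) = e^{i√z|y|} / (4π|y|)` and `R_z = (-Δ - z)⁻¹`, the Fourier multiplier with symbol
`1 / (4π²|ξ|² - z)`.

* The Fourier transform of `G_z` is this symbol (`fourier_green`): by rotation invariance the
  frequency lies on the first axis, and in the splitting `ℝ³ = ℝ × ℝ²` the integral over each plane
  has an explicit primitive.
* Consequently, for `w ∈ L²`, the function `p ↦ ⟨G_{z̄}(· - p), w⟩` is the inverse Fourier integral of
  the integrable function `ŵ / (4π²|ξ|² - z)`, hence the continuous representative of `R_z w`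
  (`resolvent_ae`). So evaluation of elements of `W^{2,2}` at `x_j` is the pairing of
  `w = (-Δ - z)u` with a fundamental solution, and `dom H` is the image under `R_z` of the
  orthogonal complement of finitely many vectors.
* Since that span is finite dimensional, `f ∈ dom H*` with `H* f = h` if and only if
  `f = R_{-1}(h + f) + ∑ a_j G_{-1}(· - x_j)` (`adjoint_minimalH_iff`). The coefficients are unique,
  because a superposition of fundamental solutions is unbounded at the poles while the first summand
  is continuous. The limits at the poles are `Γ₀ f = a` and
  `Γ₁ f = T*(h + f) + W a`, where `T a = ∑ a_j G_{-1}(· - x_j)` and `W` is the Weyl matrix at `-1`;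
  Green's identity then says that `R_{-1}` and `W` are symmetric.
* `H* ↾ ker Γ₀` is `-Δ` on `W^{2,2}`, with resolvent `R_z`. The vectors `∑ a_j G_z(· - x_j)` lie in
  `ker (H* - z)` and their boundary values are `a` and the Weyl matrix at `z` applied to `a`.

The existence and uniqueness of the Weyl function and of the `γ`-field on all of `ρ(A₀)` hold for
every boundary triplet with a finite dimensional boundary space, as `Γ₀` is bijective on `ker (A* - z)`
(`BoundaryTriplet.exists_inverse_on_defect`).
-/

noncomputable section

namespace PointInteraction

open MeasureTheory Filter Topology LineDeriv
open scoped LineDeriv Laplacian SchwartzMap FourierTransform ComplexConjugate ENNReal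

/-! ### The square root and the fundamental solution -/

lemma sqrtBranch_sq (z : ℂ) : sqrtBranch z ^ 2 = z := by
  have h : (z ^ (1 / 2 : ℂ)) ^ 2 = z := by
    rw [one_div]
    exact_mod_cast Complex.cpow_nat_inv_pow z two_ne_zero
  unfold sqrtBranch
  split_ifs
  · exact h
  · rw [neg_sq, h]

lemma sqrtBranch_im_pos {z : ℂ} (hz : z ∉ Complex.ofReal '' Set.Ici 0) :
    0 < (sqrtBranch z).im := by
  have hz0 : z ≠ 0 := by
    rintro rfl
    exact hz ⟨0, Set.mem_Ici.2 le_rfl, by simp⟩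
  have him : (z ^ (1 / 2 : ℂ)).im = Real.exp (Real.log ‖z‖ / 2) * Real.sin (z.arg / 2) := by
    rw [Complex.cpow_def_of_ne_zero hz0, Complex.exp_im]
    have h1 : (Complex.log z * (1 / 2 : ℂ)).re = Real.log ‖z‖ / 2 := by
      simp [Complex.mul_re, Complex.log_re]; ring
    have h2 : (Complex.log z * (1 / 2 : ℂ)).im = z.arg / 2 := by
      simp [Complex.mul_im, Complex.log_im]; ring
    rw [h1, h2]
  unfold sqrtBranch
  split_ifs with h
  · rw [him]
    have h0 : 0 < z.arg := by
      refine lt_of_le_of_ne (Complex.arg_nonneg_iff.2 h) fun h0 => hz ?_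
      obtain ⟨h1, h2⟩ := Complex.arg_eq_zero_iff.1 h0.symm
      exact ⟨z.re, h1, Complex.ext (by simp) (by simp [h2])⟩
    exact mul_pos (Real.exp_pos _)
      (Real.sin_pos_of_pos_of_lt_pi (by linarith) (by linarith [z.arg_le_pi, Real.pi_pos]))
  · rw [Complex.neg_im, him]
    have h0 : z.arg < 0 := Complex.arg_neg_iff.2 (not_le.1 h)
    have := Real.sin_neg_of_neg_of_neg_pi_lt (x := z.arg / 2) (by linarith)
      (by linarith [z.neg_pi_lt_arg, Real.pi_pos])
    nlinarith [Real.exp_pos (Real.log ‖z‖ / 2)]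

lemma conj_notMem_nonneg {z : ℂ} (hz : z ∉ Complex.ofReal '' Set.Ici 0) :
    conj z ∉ Complex.ofReal '' Set.Ici 0 := by
  rintro ⟨t, ht, h⟩
  refine hz ⟨t, ht, ?_⟩
  rw [← Complex.conj_ofReal, h, Complex.conj_conj]

lemma sqrtBranch_conj {z : ℂ} (hz : z ∉ Complex.ofReal '' Set.Ici 0) :
    sqrtBranch (conj z) = -conj (sqrtBranch z) := by
  have h1 := sqrtBranch_im_pos hz
  have h2 := sqrtBranch_im_pos (conj_notMem_nonneg hz)
  have h3 : sqrtBranch (conj z) ^ 2 = conj (sqrtBranch z) ^ 2 := by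
    rw [sqrtBranch_sq, ← map_pow, sqrtBranch_sq]
  rcases sq_eq_sq_iff_eq_or_eq_neg.1 h3 with h | h
  · rw [h, Complex.conj_im] at h2
    linarith
  · exact h

lemma green_conj {z : ℂ} (hz : z ∉ Complex.ofReal '' Set.Ici 0) (x : E3) :
    green (conj z) x = conj (green z x) := by
  unfold green
  rw [sqrtBranch_conj hz, map_div₀, ← Complex.exp_conj]
  simp [Complex.conj_ofNat]

lemma green_neg (z : ℂ) (x : E3) : green z (-x) = green z x := by simp [green]

lemma norm_green {z : ℂ} (x : E3) :
    ‖green z x‖ = Real.exp (-(sqrtBranch z).im * ‖x‖) / (4 * Real.pi * ‖x‖) := by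
  rw [green, norm_div, Complex.norm_exp]
  congr 2
  · simp [Complex.mul_re]
  · simp [abs_of_pos Real.pi_pos]

lemma measurable_green (z : ℂ) : Measurable (green z) := by
  unfold green; fun_prop

lemma integrable_green {z : ℂ} (hz : z ∉ Complex.ofReal '' Set.Ici 0) :
    Integrable (green z) := by
  have hb := sqrtBranch_im_pos hz
  set b := (sqrtBranch z).im
  rw [← integrable_norm_iff (measurable_green z).aestronglyMeasurable]
  simp_rw [norm_green]
  refine (integrable_fun_norm_addHaar (volume : Measure E3)
    (f := fun r => Real.exp (-b * r) / (4 * Real.pi * r))).2 ?_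
  have h := (integrableOn_rpow_mul_exp_neg_mul_rpow (p := 1) (s := 1) (b := b)
    (by norm_num) one_pos hb).div_const (4 * Real.pi)
  refine IntegrableOn.congr_fun h (fun r hr => ?_) measurableSet_Ioi
  have hr : 0 < r := hr
  have : Module.finrank ℝ E3 - 1 = 2 := by simp
  rw [this]
  simp only [Real.rpow_one, smul_eq_mul]
  field_simp

lemma memLp_two_green {z : ℂ} (hz : z ∉ Complex.ofReal '' Set.Ici 0) :
    MemLp (green z) 2 := by
  have hb := sqrtBranch_im_pos hz
  set b := (sqrtBranch z).im with hbdef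
  rw [memLp_two_iff_integrable_sq_norm (measurable_green z).aestronglyMeasurable]
  simp_rw [norm_green]
  refine (integrable_fun_norm_addHaar (volume : Measure E3)
    (f := fun r => (Real.exp (-b * r) / (4 * Real.pi * r)) ^ 2)).2 ?_
  have h := (integrableOn_exp_mul_Ioi (a := -(2 * b)) (by linarith) 0).div_const
    ((4 * Real.pi) ^ 2)
  refine IntegrableOn.congr_fun h (fun r hr => ?_) measurableSet_Ioi
  have hr : 0 < r := hr
  have : Module.finrank ℝ E3 - 1 = 2 := by simp
  rw [this]
  have h2 : Real.exp (-(2 * b) * r) = Real.exp (-b * r) ^ 2 := by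
    rw [← Real.exp_nat_mul]; congr 1; push_cast; ring
  simp only [smul_eq_mul]
  rw [h2]
  field_simp

/-- The splitting `ℝ³ = ℝ × ℝ²` into the first coordinate and the other two. -/
def splitE3 : E3 ≃ᵐ ℝ × EuclideanSpace ℝ (Fin 2) :=
  (MeasurableEquiv.toLp 2 (Fin 3 → ℝ)).symm.trans
    ((MeasurableEquiv.piFinSuccAbove (fun _ => ℝ) 0).trans
      ((MeasurableEquiv.refl ℝ).prodCongr (MeasurableEquiv.toLp 2 (Fin 2 → ℝ))))

lemma measurePreserving_splitE3 : MeasurePreserving splitE3 := by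
  have h : MeasurePreserving
      ((MeasurableEquiv.refl ℝ).prodCongr (MeasurableEquiv.toLp 2 (Fin 2 → ℝ))) :=
    (MeasurePreserving.id volume).prod (PiLp.volume_preserving_toLp (Fin 2))
  exact h.comp ((volume_preserving_piFinSuccAbove (fun _ => ℝ) 0).comp
    (EuclideanSpace.volume_preserving_symm_measurableEquiv_toLp (Fin 3)))

lemma splitE3_fst (x : E3) : (splitE3 x).1 = x 0 := rfl

lemma norm_splitE3 (x : E3) : ‖x‖ = √((splitE3 x).1 ^ 2 + ‖(splitE3 x).2‖ ^ 2) := by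
  have h : ∀ i, (splitE3 x).2 i = x i.succ := fun i => rfl
  rw [EuclideanSpace.norm_eq, EuclideanSpace.norm_eq, Real.sq_sqrt (by positivity),
    splitE3_fst, Fin.sum_univ_succ]
  simp [h]

/-- The integral over a plane at distance `|s|` from the origin of the outgoing spherical wave is a
plane wave in `s`: in polar coordinates of the plane the integrand is an exact derivative. -/
lemma integral_plane_spherical_wave {k : ℂ} (hk : 0 < k.im) (s : ℝ) :
    ∫ y : EuclideanSpace ℝ (Fin 2), Complex.exp (Complex.I * k * (√(s ^ 2 + ‖y‖ ^ 2) : ℝ)) /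
      (4 * (Real.pi : ℂ) * (√(s ^ 2 + ‖y‖ ^ 2) : ℝ)) =
    -Complex.exp (Complex.I * k * (|s| : ℝ)) / (2 * Complex.I * k) := by
  have hk0 : k ≠ 0 := by rintro rfl; simp at hk
  rw [integral_fun_norm_addHaar (volume : Measure (EuclideanSpace ℝ (Fin 2)))
    (fun r => Complex.exp (Complex.I * k * (√(s ^ 2 + r ^ 2) : ℝ)) /
      (4 * (Real.pi : ℂ) * (√(s ^ 2 + r ^ 2) : ℝ)))]
  have hball : (volume : Measure (EuclideanSpace ℝ (Fin 2))).real (Metric.ball 0 1) = Real.pi := by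
    rw [Measure.real, EuclideanSpace.volume_ball_fin_two]
    simp [Real.pi_pos.le]
  have hdim : Module.finrank ℝ (EuclideanSpace ℝ (Fin 2)) = 2 := by simp
  rw [hball, hdim]
  -- a primitive of the integrand in polar coordinates
  let F : ℝ → ℂ := fun r =>
    Complex.exp (Complex.I * k * (√(s ^ 2 + r ^ 2) : ℝ)) / (4 * Real.pi * (Complex.I * k))
  have hpos : ∀ r ∈ Set.Ioi (0 : ℝ), 0 < s ^ 2 + r ^ 2 := fun r hr => by
    have : 0 < r := hr
    positivity
  have hderiv : ∀ r ∈ Set.Ioi (0 : ℝ), HasDerivAt F (r ^ (2 - 1) •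
      (Complex.exp (Complex.I * k * (√(s ^ 2 + r ^ 2) : ℝ)) /
        (4 * (Real.pi : ℂ) * (√(s ^ 2 + r ^ 2) : ℝ)))) r := by
    intro r hr
    have hp := hpos r hr
    have h1 : HasDerivAt (fun r : ℝ => √(s ^ 2 + r ^ 2)) (2 * r / (2 * √(s ^ 2 + r ^ 2))) r := by
      refine HasDerivAt.sqrt ?_ hp.ne'
      simpa using (hasDerivAt_pow 2 r).const_add (s ^ 2)
    have h2 := ((h1.ofReal_comp.const_mul (Complex.I * k)).cexp).div_const
      (4 * Real.pi * (Complex.I * k))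
    refine h2.congr_deriv ?_
    have hs : ((√(s ^ 2 + r ^ 2) : ℝ) : ℂ) ≠ 0 := by
      exact_mod_cast (Real.sqrt_pos.2 hp).ne'
    have hpi : (Real.pi : ℂ) ≠ 0 := by exact_mod_cast Real.pi_ne_zero
    have hI := Complex.I_ne_zero
    rw [Complex.real_smul]
    push_cast
    field_simp
  have hcont : Continuous F := by fun_prop
  have hle : ∀ r : ℝ, 0 < r → r ≤ √(s ^ 2 + r ^ 2) := fun r hr =>
    Real.le_sqrt_of_sq_le (by nlinarith [sq_nonneg s])
  have hint : IntegrableOn (fun r : ℝ => r ^ (2 - 1) •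
      (Complex.exp (Complex.I * k * (√(s ^ 2 + r ^ 2) : ℝ)) /
        (4 * (Real.pi : ℂ) * (√(s ^ 2 + r ^ 2) : ℝ)))) (Set.Ioi 0) := by
    refine Integrable.mono' (integrableOn_exp_mul_Ioi (a := -k.im) (by linarith) 0)
      (by fun_prop) ?_
    refine (ae_restrict_mem measurableSet_Ioi).mono fun r hr => ?_
    have hr0 : 0 < r := hr
    have hs := hle r hr0
    have hs0 : 0 < √(s ^ 2 + r ^ 2) := hr0.trans_le hs
    rw [norm_smul, norm_div, Complex.norm_exp]
    have e1 : (Complex.I * k * (√(s ^ 2 + r ^ 2) : ℝ)).re = -k.im * √(s ^ 2 + r ^ 2) := by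
      simp [Complex.mul_re]
    have e2 : ‖(4 * (Real.pi : ℂ) * (√(s ^ 2 + r ^ 2) : ℝ))‖ = 4 * Real.pi * √(s ^ 2 + r ^ 2) := by
      simp [abs_of_pos Real.pi_pos]
    rw [e1, e2, Real.norm_of_nonneg (by positivity), mul_div_assoc', div_le_iff₀ (by positivity)]
    have h3 : Real.exp (-k.im * √(s ^ 2 + r ^ 2)) ≤ Real.exp (-k.im * r) :=
      Real.exp_le_exp.2 (by nlinarith)
    have h4 : r ^ (2 - 1) ≤ 4 * Real.pi * √(s ^ 2 + r ^ 2) := by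
      have := Real.pi_gt_three
      simp only [Nat.add_one_sub_one, pow_one]
      nlinarith
    calc r ^ (2 - 1) * Real.exp (-k.im * √(s ^ 2 + r ^ 2))
        ≤ (4 * Real.pi * √(s ^ 2 + r ^ 2)) * Real.exp (-k.im * r) := by gcongr
      _ = _ := mul_comm _ _
  have hlim : Tendsto F atTop (𝓝 0) := by
    rw [tendsto_zero_iff_norm_tendsto_zero]
    have h5 : Tendsto (fun r : ℝ => Real.exp (-k.im * r) / ‖4 * Real.pi * (Complex.I * k)‖)
        atTop (𝓝 0) := by
      have : Tendsto (fun r : ℝ => Real.exp (-k.im * r)) atTop (𝓝 0) :=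
        Real.tendsto_exp_atBot.comp (tendsto_id.const_mul_atTop_of_neg (by linarith))
      simpa using this.div_const ‖4 * Real.pi * (Complex.I * k)‖
    refine tendsto_of_tendsto_of_tendsto_of_le_of_le' tendsto_const_nhds h5
      (Eventually.of_forall fun _ => norm_nonneg _) ?_
    filter_upwards [eventually_gt_atTop 0] with r hr
    simp only [F]
    rw [norm_div, Complex.norm_exp]
    gcongr
    have e1 : (Complex.I * k * (√(s ^ 2 + r ^ 2) : ℝ)).re = -k.im * √(s ^ 2 + r ^ 2) := by
      simp [Complex.mul_re]
    rw [e1]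
    have := hle r hr
    nlinarith
  rw [integral_Ioi_of_hasDerivAt_of_tendsto hcont.continuousWithinAt hderiv hint hlim]
  have hpi : (Real.pi : ℂ) ≠ 0 := by exact_mod_cast Real.pi_ne_zero
  have hI := Complex.I_ne_zero
  simp only [F, ne_eq, OfNat.ofNat_ne_zero, not_false_eq_true, zero_pow, add_zero, Real.sqrt_sq_eq_abs,
    nsmul_eq_mul, Complex.real_smul]
  push_cast
  field_simp
  ring

/-- The Fourier transform of `e^{ik|s|}` in one dimension. -/
lemma integral_exp_abs {k : ℂ} (hk : 0 < k.im) (t : ℝ) :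
    ∫ s : ℝ, Complex.exp (-(2 * Real.pi * t * Complex.I) * s) *
      Complex.exp (Complex.I * k * (|s| : ℝ)) =
    -(2 * Complex.I * k) / (4 * Real.pi ^ 2 * t ^ 2 - k ^ 2) := by
  -- the exponents on the two half-lines
  set a : ℂ := -(2 * Real.pi * t * Complex.I) + Complex.I * k with ha
  set b : ℂ := -(2 * Real.pi * t * Complex.I) - Complex.I * k with hb
  have hare : a.re < 0 := by simp [ha, hk]
  have hbre : 0 < b.re := by simp [hb, hk]
  have e1 : ∀ s ∈ Set.Ioi (0 : ℝ), Complex.exp (-(2 * Real.pi * t * Complex.I) * s) *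
      Complex.exp (Complex.I * k * (|s| : ℝ)) = Complex.exp (a * s) := by
    intro s hs
    rw [abs_of_pos hs, ← Complex.exp_add, ha]
    ring_nf
  have e2 : ∀ s ∈ Set.Iic (0 : ℝ), Complex.exp (-(2 * Real.pi * t * Complex.I) * s) *
      Complex.exp (Complex.I * k * (|s| : ℝ)) = Complex.exp (b * s) := by
    intro s hs
    rw [abs_of_nonpos hs, ← Complex.exp_add, hb]
    push_cast
    ring_nf
  have i1 : IntegrableOn (fun s : ℝ => Complex.exp (a * s)) (Set.Ioi 0) :=
    integrableOn_exp_mul_complex_Ioi hare 0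
  have i2 : IntegrableOn (fun s : ℝ => Complex.exp (b * s)) (Set.Iic 0) :=
    integrableOn_exp_mul_complex_Iic hbre 0
  rw [← intervalIntegral.integral_Iic_add_Ioi (b := 0) (i2.congr_fun (fun s hs => (e2 s hs).symm)
    measurableSet_Iic) (i1.congr_fun (fun s hs => (e1 s hs).symm) measurableSet_Ioi),
    setIntegral_congr_fun measurableSet_Ioi e1, setIntegral_congr_fun measurableSet_Iic e2,
    integral_exp_mul_complex_Ioi hare, integral_exp_mul_complex_Iic hbre]
  have ha0 : a ≠ 0 := by rintro h; simp [h] at hare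
  have hb0 : b ≠ 0 := by rintro h; simp [h] at hbre
  have hab : a * b = k ^ 2 - 4 * Real.pi ^ 2 * t ^ 2 := by
    rw [ha, hb]
    linear_combination (4 * Real.pi ^ 2 * t ^ 2 - k ^ 2) * Complex.I_sq
  have hd : (4 * Real.pi ^ 2 * t ^ 2 - k ^ 2 : ℂ) = -(a * b) := by rw [hab]; ring
  rw [hd]
  have : (2 * Complex.I * k) = a - b := by rw [ha, hb]; ring
  rw [this]
  simp only [Complex.ofReal_zero, mul_zero, Complex.exp_zero]
  field_simp
  ring

/-- The symbol of the resolvent of `-Δ`. -/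
def symb (z : ℂ) (ξ : E3) : ℂ := 1 / (4 * Real.pi ^ 2 * (‖ξ‖ : ℂ) ^ 2 - z)

/-- The Fourier transform of the fundamental solution. By rotation invariance the frequency may be
taken along the first axis; then the integral over the planes orthogonal to it is explicit. -/
lemma fourier_green {z : ℂ} (hz : z ∉ Complex.ofReal '' Set.Ici 0) (ξ : E3) :
    𝓕 (green z) ξ = symb z ξ := by
  have hk := sqrtBranch_im_pos hz
  set k := sqrtBranch z with hkdef
  let e : E3 := EuclideanSpace.single 0 1
  have hn : ‖ξ‖ = ‖‖ξ‖ • e‖ := by simp [e, norm_smul]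
  -- the reflection that exchanges `ξ` and `|ξ| e`
  let A := Submodule.reflection (ℝ ∙ (ξ - ‖ξ‖ • e))ᗮ
  have hA : A ξ = ‖ξ‖ • e := Submodule.reflection_sub hn
  have hcomp : green z ∘ A = green z := by
    funext x
    simp [green]
  rw [← hcomp, Real.fourier_comp_linearIsometry, hA, Real.fourier_eq']
  have hinner : ∀ v : E3, (inner ℝ v (‖ξ‖ • e) : ℝ) = ‖ξ‖ * v 0 := by
    intro v
    rw [inner_smul_right]
    simp [e, EuclideanSpace.inner_single_right]
  let F : ℝ × EuclideanSpace ℝ (Fin 2) → ℂ := fun p =>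
    Complex.exp (-(2 * Real.pi * ‖ξ‖ * Complex.I) * p.1) *
      (Complex.exp (Complex.I * k * (√(p.1 ^ 2 + ‖p.2‖ ^ 2) : ℝ)) /
        (4 * (Real.pi : ℂ) * (√(p.1 ^ 2 + ‖p.2‖ ^ 2) : ℝ)))
  have hF : ∀ v : E3, Complex.exp (↑(-2 * Real.pi * inner ℝ v (‖ξ‖ • e)) * Complex.I) •
      green z v = F (splitE3 v) := by
    intro v
    simp only [F]
    rw [hinner, smul_eq_mul, green, norm_splitE3 v, splitE3_fst]
    congr 2
    push_cast
    ring
  have hFint : Integrable F (volume.prod volume) := by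
    rw [← Measure.volume_eq_prod, ← measurePreserving_splitE3.integrable_comp_emb
      splitE3.measurableEmbedding]
    have h := (Real.fourierIntegral_convergent_iff (μ := volume) (f := green z) (‖ξ‖ • e)).2
      (integrable_green hz)
    refine h.congr (Eventually.of_forall fun v => ?_)
    beta_reduce
    rw [Function.comp_apply, ← hF v, Circle.smul_def, Real.fourierChar_apply]
    congr 2
    push_cast
    ring
  simp_rw [hF]
  rw [measurePreserving_splitE3.integral_comp splitE3.measurableEmbedding, Measure.volume_eq_prod,
    integral_prod _ hFint]
  have h1 : ∀ s : ℝ, ∫ y, F (s, y) = Complex.exp (-(2 * Real.pi * ‖ξ‖ * Complex.I) * s) *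
      Complex.exp (Complex.I * k * (|s| : ℝ)) * (-1 / (2 * Complex.I * k)) := by
    intro s
    simp only [F]
    rw [integral_const_mul, integral_plane_spherical_wave hk]
    ring
  simp_rw [h1]
  rw [integral_mul_const, integral_exp_abs hk, hkdef, sqrtBranch_sq, symb]
  have hk0 : sqrtBranch z ≠ 0 := by
    intro h
    rw [hkdef, h] at hk
    simp at hk
  have hI := Complex.I_ne_zero
  rw [← hkdef] at *
  field_simp

/-! ### Fourier multipliers and the free resolvent -/

/-- Locally integrable functions that agree as tempered distributions agree almost everywhere. -/
lemma ae_eq_of_forall_schwartz {f g : E3 → ℂ} (hf : LocallyIntegrable f)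
    (hg : LocallyIntegrable g)
    (h : ∀ φ : 𝓢(E3, ℂ), ∫ x, φ x • f x = ∫ x, φ x • g x) : f =ᵐ[volume] g := by
  refine ae_eq_of_integral_contDiff_smul_eq hf hg fun χ hχ hc => ?_
  have h1 : HasCompactSupport (Complex.ofRealCLM ∘ χ) := hc.comp_left rfl
  have h2 : ContDiff ℝ _ (Complex.ofRealCLM ∘ χ) := Complex.ofRealCLM.contDiff.comp hχ
  have := h (h1.toSchwartzMap h2)
  simpa using this

lemma locallyIntegrable_coe (f : L2) : LocallyIntegrable f :=
  (Lp.memLp f).locallyIntegrable (by norm_num)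

lemma locallyIntegrable_mul_coe {p : E3 → ℂ} (hp : Continuous p) (f : L2) :
    LocallyIntegrable (fun ξ => p ξ * f ξ) := by
  rw [locallyIntegrable_iff]
  intro K hK
  exact ((locallyIntegrable_coe f).integrableOn_isCompact hK).continuousOn_mul hp.continuousOn hK

lemma smulLeftCLM_eq_iff {p : E3 → ℂ} (hp : p.HasTemperateGrowth) (f g : L2) :
    TemperedDistribution.smulLeftCLM ℂ p (f : 𝓢'(E3, ℂ)) = (g : 𝓢'(E3, ℂ)) ↔
      g =ᵐ[volume] fun ξ => p ξ * f ξ := by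
  have key : ∀ φ : 𝓢(E3, ℂ), TemperedDistribution.smulLeftCLM ℂ p (f : 𝓢'(E3, ℂ)) φ =
      ∫ ξ, φ ξ • (p ξ * f ξ) := by
    intro φ
    rw [TemperedDistribution.smulLeftCLM_apply_apply, Lp.toTemperedDistribution_apply]
    congr 1
    funext ξ
    simp [hp]
    ring
  constructor
  · intro h
    refine ae_eq_of_forall_schwartz (locallyIntegrable_coe g)
      (locallyIntegrable_mul_coe hp.1.continuous f) fun φ => ?_
    rw [← key, h, Lp.toTemperedDistribution_apply]
  · intro h
    ext φ
    rw [key, Lp.toTemperedDistribution_apply]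
    refine integral_congr_ae ?_
    filter_upwards [h] with ξ hξ
    rw [hξ]

lemma fourier_dist_injective : Function.Injective (fun u : 𝓢'(E3, ℂ) => 𝓕 u) := by
  intro u v h
  have := congrArg (fun w : 𝓢'(E3, ℂ) => 𝓕⁻ w) h
  simpa using this

/-- The Laplacian of an `L²` function is multiplication by `-4π²|ξ|²` on the Fourier side. -/
lemma laplacian_eq_iff (f g : L2) :
    Δ (f : 𝓢'(E3, ℂ)) = (g : 𝓢'(E3, ℂ)) ↔
      (𝓕 g : L2) =ᵐ[volume] fun ξ => -(4 * Real.pi ^ 2 * (‖ξ‖ : ℂ) ^ 2) * (𝓕 f : L2) ξ := by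
  have hp0 : (fun ξ : E3 => Complex.ofReal (‖ξ‖ ^ 2)).HasTemperateGrowth := by fun_prop
  have hp : (fun ξ : E3 => -(4 * Real.pi ^ 2 * (‖ξ‖ : ℂ) ^ 2)).HasTemperateGrowth := by
    have := (Function.HasTemperateGrowth.const (E := E3) (-(4 * Real.pi ^ 2 : ℂ))).mul hp0
    refine (congrArg Function.HasTemperateGrowth (funext fun ξ => ?_)).mp this
    simp
  rw [← smulLeftCLM_eq_iff hp, ← Lp.fourier_toTemperedDistribution_eq,
    ← Lp.fourier_toTemperedDistribution_eq, ← fourier_dist_injective.eq_iff]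
  have : 𝓕 (Δ (f : 𝓢'(E3, ℂ))) = TemperedDistribution.smulLeftCLM ℂ
      (fun ξ : E3 => -(4 * Real.pi ^ 2 * (‖ξ‖ : ℂ) ^ 2)) (𝓕 (f : 𝓢'(E3, ℂ))) := by
    rw [TemperedDistribution.laplacian_eq_fourierMultiplierCLM,
      TemperedDistribution.fourierMultiplierCLM_apply, ← Complex.coe_smul,
      FourierTransform.fourier_smul, FourierTransform.fourier_fourierInv_eq,
      ← smul_apply, ← TemperedDistribution.smulLeftCLM_smul hp0]
    congr 2
    funext ξ
    simp only [Pi.smul_apply, smul_eq_mul]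
    push_cast
    ring
  simp only [this]

/-- A derivative of an `L²` function, computed on the Fourier side. -/
lemma lineDeriv_eq_of_fourier (v : E3) {f g : L2}
    (h : (𝓕 g : L2) =ᵐ[volume] fun ξ => 2 * Real.pi * Complex.I * (inner ℝ ξ v : ℝ) * (𝓕 f : L2) ξ) :
    ∂_{v} (f : 𝓢'(E3, ℂ)) = (g : 𝓢'(E3, ℂ)) := by
  have hp0 : (fun ξ : E3 => ((inner ℝ ξ v : ℝ) : ℂ)).HasTemperateGrowth := by fun_prop
  have hp : (fun ξ : E3 => 2 * Real.pi * Complex.I * ((inner ℝ ξ v : ℝ) : ℂ)).HasTemperateGrowth :=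
    (Function.HasTemperateGrowth.const (E := E3) (2 * Real.pi * Complex.I)).mul hp0
  rw [← smulLeftCLM_eq_iff hp, ← Lp.fourier_toTemperedDistribution_eq,
    ← Lp.fourier_toTemperedDistribution_eq] at h
  refine fourier_dist_injective ?_
  simp only
  rw [← h, TemperedDistribution.fourier_lineDerivOp_eq, ← smul_apply,
    ← TemperedDistribution.smulLeftCLM_smul hp0]
  rfl

/-- Multiplication of `L²` functions by a bounded function. -/
def mulCLM {φ : E3 → ℂ} (hφ : MemLp φ ∞) : L2 →L[ℂ] L2 :=
  (ContinuousLinearMap.mul ℂ ℂ).holderL volume ∞ 2 2 (hφ.toLp φ)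

lemma mulCLM_ae {φ : E3 → ℂ} (hφ : MemLp φ ∞) (f : L2) :
    mulCLM hφ f =ᵐ[volume] fun ξ => φ ξ * f ξ := by
  have h := (ContinuousLinearMap.mul ℂ ℂ).coeFn_holder (r := 2) (hφ.toLp φ) f
  filter_upwards [h, hφ.coeFn_toLp] with ξ h1 h2
  rw [mulCLM]
  erw [h1]
  simp [h2]

lemma exists_fourier_eq_mul {φ : E3 → ℂ} (hφ : MemLp φ ∞) (f : L2) :
    ∃ g : L2, (𝓕 g : L2) =ᵐ[volume] fun ξ => φ ξ * f ξ :=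
  ⟨𝓕⁻ (mulCLM hφ f), by
    rw [FourierTransform.fourier_fourierInv_eq]
    exact mulCLM_ae hφ f⟩

lemma four_pi_sq_sub_ne_zero {z : ℂ} (hz : z ∉ Complex.ofReal '' Set.Ici 0) (ξ : E3) :
    (4 * Real.pi ^ 2 * (‖ξ‖ : ℂ) ^ 2 - z) ≠ 0 := by
  intro h
  refine hz ⟨4 * Real.pi ^ 2 * ‖ξ‖ ^ 2, Set.mem_Ici.2 (by positivity), ?_⟩
  push_cast
  linear_combination h

lemma continuous_symb {z : ℂ} (hz : z ∉ Complex.ofReal '' Set.Ici 0) : Continuous (symb z) := by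
  unfold symb
  exact continuous_const.div (by fun_prop) (four_pi_sq_sub_ne_zero hz)

/-- The symbol decays like `|ξ|⁻²` at infinity. -/
lemma exists_norm_symb_le {z : ℂ} (hz : z ∉ Complex.ofReal '' Set.Ici 0) :
    ∃ C : ℝ, ∀ ξ : E3, (1 + ‖ξ‖ ^ 2) * ‖symb z ξ‖ ≤ C := by
  have hcl : IsClosed (Complex.ofReal '' Set.Ici 0) :=
    Complex.isometry_ofReal.isClosedEmbedding.isClosedMap _ isClosed_Ici
  have hd : 0 < Metric.infDist z (Complex.ofReal '' Set.Ici 0) :=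
    (hcl.notMem_iff_infDist_pos ⟨_, Set.mem_image_of_mem _ (Set.mem_Ici.2 le_rfl)⟩).1 hz
  set d := Metric.infDist z (Complex.ofReal '' Set.Ici 0)
  refine ⟨1 + (1 + ‖z‖) / d, fun ξ => ?_⟩
  set t : ℝ := 4 * Real.pi ^ 2 * ‖ξ‖ ^ 2 with ht
  have ht0 : 0 ≤ t := by positivity
  have htc : (4 * Real.pi ^ 2 * (‖ξ‖ : ℂ) ^ 2 - z) = t - z := by rw [ht]; push_cast; ring
  have h1 : d ≤ ‖(t : ℂ) - z‖ := by
    rw [← dist_eq_norm, dist_comm]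
    exact Metric.infDist_le_dist_of_mem ⟨t, ht0, rfl⟩
  have h2 : t ≤ ‖(t : ℂ) - z‖ + ‖z‖ := by
    calc t = ‖(t : ℂ)‖ := by rw [Complex.norm_real, Real.norm_of_nonneg ht0]
      _ = ‖((t : ℂ) - z) + z‖ := by rw [sub_add_cancel]
      _ ≤ _ := norm_add_le _ _
  have h3 : ‖ξ‖ ^ 2 ≤ t := by
    rw [ht]
    nlinarith [Real.pi_gt_three, sq_nonneg ‖ξ‖, mul_nonneg (sq_nonneg ‖ξ‖) (sq_nonneg (Real.pi - 1))]
  rw [symb, htc, norm_div, norm_one, mul_one_div, div_le_iff₀ (hd.trans_le h1), add_mul, one_mul]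
  have h4 : 1 + ‖z‖ ≤ (1 + ‖z‖) / d * ‖(t : ℂ) - z‖ := by
    rw [div_mul_eq_mul_div, le_div_iff₀ hd]
    gcongr
  linarith

lemma memLp_top_of_norm_le_symb {z : ℂ} (hz : z ∉ Complex.ofReal '' Set.Ici 0) {φ : E3 → ℂ}
    (hφ : Continuous φ) {c : ℝ} (h : ∀ ξ, ‖φ ξ‖ ≤ c * (1 + ‖ξ‖ ^ 2)) :
    MemLp (fun ξ => φ ξ * symb z ξ) ∞ := by
  obtain ⟨C, hC⟩ := exists_norm_symb_le hz
  have hc : 0 ≤ c := by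
    have := (norm_nonneg _).trans (h 0)
    simpa using this
  refine memLp_top_of_bound (hφ.mul (continuous_symb hz)).aestronglyMeasurable (c * C)
    (Eventually.of_forall fun ξ => ?_)
  rw [norm_mul]
  calc ‖φ ξ‖ * ‖symb z ξ‖ ≤ c * (1 + ‖ξ‖ ^ 2) * ‖symb z ξ‖ := by gcongr; exact h ξ
    _ = c * ((1 + ‖ξ‖ ^ 2) * ‖symb z ξ‖) := by ring
    _ ≤ c * C := by gcongr; exact hC ξ

lemma memLp_top_symb {z : ℂ} (hz : z ∉ Complex.ofReal '' Set.Ici 0) : MemLp (symb z) ∞ := by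
  have := memLp_top_of_norm_le_symb hz (φ := fun _ => 1) (c := 1) continuous_const fun ξ => by
    rw [norm_one, one_mul]
    linarith [sq_nonneg ‖ξ‖]
  simpa using this

/-- The resolvent `(-Δ - z)⁻¹` of the free Laplacian, as a Fourier multiplier. -/
def resolvent {z : ℂ} (hz : z ∉ Complex.ofReal '' Set.Ici 0) : L2 →L[ℂ] L2 :=
  (FourierTransform.fourierInvCLM ℂ L2) ∘L mulCLM (memLp_top_symb hz) ∘L
    (FourierTransform.fourierCLM ℂ L2)

lemma fourier_resolvent {z : ℂ} (hz : z ∉ Complex.ofReal '' Set.Ici 0) (w : L2) :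
    (𝓕 (resolvent hz w) : L2) =ᵐ[volume] fun ξ => symb z ξ * (𝓕 w : L2) ξ := by
  have : (𝓕 (resolvent hz w) : L2) = mulCLM (memLp_top_symb hz) (𝓕 w) := by
    simp [resolvent]
  rw [this]
  exact mulCLM_ae _ _

lemma norm_inner_le_one_add_sq (ξ v : E3) :
    ‖(2 * Real.pi * Complex.I * ((inner ℝ ξ v : ℝ) : ℂ))‖ ≤ 2 * Real.pi * ‖v‖ * ‖ξ‖ := by
  have h := abs_real_inner_le_norm ξ v
  simp only [norm_mul, Complex.norm_ofNat, Complex.norm_real, Complex.norm_I, mul_one,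
    Real.norm_eq_abs, abs_of_pos Real.pi_pos]
  nlinarith [Real.pi_pos]

lemma resolvent_mem_W22 {z : ℂ} (hz : z ∉ Complex.ofReal '' Set.Ici 0) (w : L2) :
    resolvent hz w ∈ W22 := by
  have h1 : ∀ v : E3, ∃ g : L2, (𝓕 g : L2) =ᵐ[volume]
      fun ξ => (2 * Real.pi * Complex.I * (inner ℝ ξ v : ℝ) * symb z ξ) * (𝓕 w : L2) ξ := by
    intro v
    refine exists_fourier_eq_mul (memLp_top_of_norm_le_symb hz (c := 2 * Real.pi * ‖v‖)
      (by fun_prop) fun ξ => (norm_inner_le_one_add_sq ξ v).trans ?_) _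
    gcongr
    nlinarith [sq_nonneg (‖ξ‖ - 1)]
  have h2 : ∀ v u : E3, ∃ g : L2, (𝓕 g : L2) =ᵐ[volume]
      fun ξ => ((2 * Real.pi * Complex.I * (inner ℝ ξ v : ℝ)) *
        (2 * Real.pi * Complex.I * (inner ℝ ξ u : ℝ)) * symb z ξ) * (𝓕 w : L2) ξ := by
    intro v u
    refine exists_fourier_eq_mul (memLp_top_of_norm_le_symb hz
      (c := (2 * Real.pi * ‖v‖) * (2 * Real.pi * ‖u‖)) (by fun_prop) fun ξ => ?_) _
    rw [norm_mul]
    calc _ ≤ (2 * Real.pi * ‖v‖ * ‖ξ‖) * (2 * Real.pi * ‖u‖ * ‖ξ‖) := by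
          gcongr <;> exact norm_inner_le_one_add_sq ξ _
      _ = (2 * Real.pi * ‖v‖) * (2 * Real.pi * ‖u‖) * ‖ξ‖ ^ 2 := by ring
      _ ≤ _ := by gcongr; linarith
  have h3 : ∀ (v : E3) (g : L2), (𝓕 g : L2) =ᵐ[volume]
      (fun ξ => (2 * Real.pi * Complex.I * (inner ℝ ξ v : ℝ) * symb z ξ) * (𝓕 w : L2) ξ) →
      ∂_{v} (resolvent hz w : 𝓢'(E3, ℂ)) = (g : 𝓢'(E3, ℂ)) := by
    intro v g hg
    refine lineDeriv_eq_of_fourier v ?_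
    filter_upwards [hg, fourier_resolvent hz w] with ξ a b
    rw [a, b]
    ring
  refine ⟨fun v => ?_, fun v u => ?_⟩
  · obtain ⟨g, hg⟩ := h1 v
    exact ⟨g, h3 v g hg⟩
  · obtain ⟨g, hg⟩ := h1 u
    obtain ⟨g', hg'⟩ := h2 v u
    rw [h3 u g hg]
    refine ⟨g', lineDeriv_eq_of_fourier v ?_⟩
    filter_upwards [hg, hg'] with ξ a b
    rw [a, b]
    ring

lemma fourier_add_smul_ae (c : ℂ) (f g : L2) :
    (𝓕 (f + c • g) : L2) =ᵐ[volume] fun ξ => (𝓕 f : L2) ξ + c * (𝓕 g : L2) ξ := by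
  rw [FourierTransform.fourier_add, FourierTransform.fourier_smul]
  filter_upwards [Lp.coeFn_add (𝓕 f : L2) (c • 𝓕 g), Lp.coeFn_smul c (𝓕 g : L2)] with ξ a b
  rw [a, Pi.add_apply, b]
  rfl

/-- `f = (-Δ - z)⁻¹ w` if and only if `-Δ f = w + z f`. -/
lemma laplacian_eq_neg_iff {z : ℂ} (hz : z ∉ Complex.ofReal '' Set.Ici 0) (f w : L2) :
    Δ (f : 𝓢'(E3, ℂ)) = ((-(w + z • f) : L2) : 𝓢'(E3, ℂ)) ↔ f = resolvent hz w := by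
  have hinj : ∀ a b : L2, (𝓕 a : L2) = 𝓕 b → a = b := fun a b h => by
    simpa using congrArg (fun w : L2 => (𝓕⁻ w : L2)) h
  have hneg : (𝓕 (-(w + z • f)) : L2) =ᵐ[volume]
      fun ξ => -((𝓕 w : L2) ξ + z * (𝓕 f : L2) ξ) := by
    have e : (𝓕 (-(w + z • f)) : L2) = -(𝓕 (w + z • f)) :=
      map_neg (Lp.fourierTransformₗᵢ E3 ℂ) _
    rw [e]
    filter_upwards [Lp.coeFn_neg (𝓕 (w + z • f) : L2), fourier_add_smul_ae z w f] with ξ a b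
    rw [a, Pi.neg_apply, b]
  rw [laplacian_eq_iff]
  constructor
  · intro h
    refine hinj _ _ (Lp.ext ?_)
    filter_upwards [h, hneg, fourier_resolvent hz w] with ξ a b c
    rw [c, symb]
    have := four_pi_sq_sub_ne_zero hz ξ
    rw [b] at a
    field_simp
    linear_combination a
  · rintro rfl
    filter_upwards [hneg, fourier_resolvent hz w] with ξ b c
    rw [b, c, symb]
    have := four_pi_sq_sub_ne_zero hz ξ
    field_simp
    ring

lemma symb_conj (z : ℂ) (ξ : E3) : symb (conj z) ξ = conj (symb z ξ) := by
  simp [symb, Complex.conj_ofNat]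

lemma inner_resolvent {z : ℂ} (hz : z ∉ Complex.ofReal '' Set.Ici 0) (v w : L2) :
    inner ℂ (resolvent hz v) w = inner ℂ v (resolvent (conj_notMem_nonneg hz) w) := by
  rw [← Lp.inner_fourier_eq, ← Lp.inner_fourier_eq v, L2.inner_def, L2.inner_def]
  refine integral_congr_ae ?_
  filter_upwards [fourier_resolvent hz v, fourier_resolvent (conj_notMem_nonneg hz) w] with ξ a b
  rw [a, b, symb_conj]
  simp only [RCLike.inner_apply, map_mul]
  ring

/-! ### Fourier inversion and the continuous representative -/

lemma continuous_fourier_of_integrable {f : E3 → ℂ} (hf : Integrable f) : Continuous (𝓕 f) :=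
  VectorFourier.fourierIntegral_continuous Real.continuous_fourierChar
    (L := innerₗ E3) continuous_inner hf

lemma continuous_fourierInv_of_integrable {f : E3 → ℂ} (hf : Integrable f) :
    Continuous (𝓕⁻ f) := by
  have : 𝓕⁻ f = fun x => 𝓕 f (-x) := funext fun x => Real.fourierInv_eq_fourier_neg f x
  rw [this]
  exact (continuous_fourier_of_integrable hf).comp continuous_neg

lemma integral_schwartz_fourier (φ : 𝓢(E3, ℂ)) {f : E3 → ℂ} (hf : Integrable f) :
    ∫ x, (𝓕 φ) x • f x = ∫ x, φ x • 𝓕 f x := by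
  have := VectorFourier.integral_fourierIntegral_smul_eq_flip (L := innerₗ E3)
    Real.continuous_fourierChar continuous_inner φ.integrable hf (μ := volume) (ν := volume)
  rw [flip_innerₗ] at this
  rw [SchwartzMap.fourier_coe]
  exact this

/-- For functions in `L¹ ∩ L²` the Fourier integral is the `L²` Fourier transform. -/
lemma fourier_toLp_ae {f : E3 → ℂ} (h1 : Integrable f) (h2 : MemLp f 2) :
    (𝓕 (h2.toLp f) : L2) =ᵐ[volume] 𝓕 f := by
  refine ae_eq_of_forall_schwartz (locallyIntegrable_coe _)
    (continuous_fourier_of_integrable h1).locallyIntegrable fun φ => ?_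
  rw [← Lp.toTemperedDistribution_apply, ← Lp.fourier_toTemperedDistribution_eq,
    TemperedDistribution.fourier_apply, Lp.toTemperedDistribution_apply,
    ← integral_schwartz_fourier φ h1]
  refine integral_congr_ae ?_
  filter_upwards [h2.coeFn_toLp] with x hx
  rw [hx]

lemma fourierInv_toLp_ae {f : E3 → ℂ} (h1 : Integrable f) (h2 : MemLp f 2) :
    (𝓕⁻ (h2.toLp f) : L2) =ᵐ[volume] 𝓕⁻ f := by
  refine ae_eq_of_forall_schwartz (locallyIntegrable_coe _)
    (continuous_fourierInv_of_integrable h1).locallyIntegrable fun φ => ?_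
  rw [← Lp.toTemperedDistribution_apply, ← Lp.fourierInv_toTemperedDistribution_eq,
    TemperedDistribution.fourierInv_apply, Lp.toTemperedDistribution_apply]
  have h3 : ∀ x, (𝓕⁻ φ) x = (𝓕 φ) (-x) := fun x => by
    rw [SchwartzMap.fourierInv_coe, SchwartzMap.fourier_coe, Real.fourierInv_eq_fourier_neg]
  calc ∫ x, (𝓕⁻ φ) x • (h2.toLp f) x = ∫ x, (𝓕 φ) (-x) • f x := by
        refine integral_congr_ae ?_
        filter_upwards [h2.coeFn_toLp] with x hx
        rw [hx, h3]
    _ = ∫ x, (𝓕 φ) x • f (-x) := by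
        have h := integral_neg_eq_self (fun x => (𝓕 φ) x • f (-x)) (volume : Measure E3)
        simpa only [neg_neg] using h
    _ = ∫ x, φ x • 𝓕 (fun y => f (-y)) x := integral_schwartz_fourier φ h1.comp_neg
    _ = _ := by rw [Real.fourierInv_eq_fourier_comp_neg]

lemma memLp_two_green_sub {z : ℂ} (hz : z ∉ Complex.ofReal '' Set.Ici 0) (p : E3) :
    MemLp (fun y => green z (y - p)) 2 :=
  (memLp_two_green hz).comp_measurePreserving (measurePreserving_sub_right volume p)

/-- The fundamental solution `e^{i√z|x - p|} / (4π|x - p|)` of `-Δ - z` with pole at `p`, as an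
element of `L²(ℝ³)`. -/
def greenLp {z : ℂ} (hz : z ∉ Complex.ofReal '' Set.Ici 0) (p : E3) : L2 :=
  (memLp_two_green_sub hz p).toLp _

lemma greenLp_ae {z : ℂ} (hz : z ∉ Complex.ofReal '' Set.Ici 0) (p : E3) :
    greenLp hz p =ᵐ[volume] fun y => green z (y - p) :=
  (memLp_two_green_sub hz p).coeFn_toLp

lemma fourier_greenLp {z : ℂ} (hz : z ∉ Complex.ofReal '' Set.Ici 0) (p : E3) :
    (𝓕 (greenLp hz p) : L2) =ᵐ[volume]
      fun ξ => Complex.exp ((-2 * Real.pi * inner ℝ p ξ : ℝ) * Complex.I) * symb z ξ := by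
  refine (fourier_toLp_ae ((integrable_green hz).comp_sub_right p)
    (memLp_two_green_sub hz p)).trans (Eventually.of_forall fun ξ => ?_)
  beta_reduce
  rw [← fourier_green hz, Real.fourier_eq', Real.fourier_eq', ← integral_const_mul,
    ← integral_add_right_eq_self _ p]
  congr 1
  funext v
  rw [add_sub_cancel_right, inner_add_left, smul_eq_mul, smul_eq_mul, ← mul_assoc,
    ← Complex.exp_add]
  congr 2
  push_cast
  ring

lemma memLp_two_symb {z : ℂ} (hz : z ∉ Complex.ofReal '' Set.Ici 0) : MemLp (symb z) 2 := by
  refine (memLp_congr_ae ?_).1 (Lp.memLp (𝓕 (greenLp hz 0) : L2))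
  filter_upwards [fourier_greenLp hz 0] with ξ h
  simp [h]

/-- Pairing with the fundamental solution is Fourier inversion. -/
lemma inner_greenLp {z : ℂ} (hz : z ∉ Complex.ofReal '' Set.Ici 0) (p : E3) (w : L2) :
    inner ℂ (greenLp (conj_notMem_nonneg hz) p) w =
      𝓕⁻ (fun ξ => symb z ξ * (𝓕 w : L2) ξ) p := by
  rw [← Lp.inner_fourier_eq, L2.inner_def, Real.fourierInv_eq']
  refine integral_congr_ae ?_
  filter_upwards [fourier_greenLp (conj_notMem_nonneg hz) p] with ξ h
  rw [h, symb_conj]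
  simp only [RCLike.inner_apply, map_mul, ← Complex.exp_conj, smul_eq_mul, Complex.conj_ofReal,
    Complex.conj_I, Complex.conj_conj]
  rw [real_inner_comm ξ p]
  have : ((-2 * Real.pi * inner ℝ ξ p : ℝ) : ℂ) * -Complex.I =
      ((2 * Real.pi * inner ℝ ξ p : ℝ) : ℂ) * Complex.I := by push_cast; ring
  rw [this]
  ring

lemma integrable_symb_mul {z : ℂ} (hz : z ∉ Complex.ofReal '' Set.Ici 0) (w : L2) :
    Integrable (fun ξ => symb z ξ * (𝓕 w : L2) ξ) :=
  (memLp_two_symb hz).integrable_mul (Lp.memLp _)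

/-- Sobolev embedding: the elements of the range of the resolvent have continuous representatives,
whose values are the pairings with the fundamental solution. -/
lemma continuous_inner_greenLp {z : ℂ} (hz : z ∉ Complex.ofReal '' Set.Ici 0) (w : L2) :
    Continuous fun p => inner ℂ (greenLp (conj_notMem_nonneg hz) p) w := by
  simp_rw [inner_greenLp hz]
  exact continuous_fourierInv_of_integrable (integrable_symb_mul hz w)

lemma resolvent_ae {z : ℂ} (hz : z ∉ Complex.ofReal '' Set.Ici 0) (w : L2) :
    resolvent hz w =ᵐ[volume] fun p => inner ℂ (greenLp (conj_notMem_nonneg hz) p) w := by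
  simp_rw [inner_greenLp hz]
  have h2 : MemLp (fun ξ => symb z ξ * (𝓕 w : L2) ξ) 2 :=
    (memLp_congr_ae (fourier_resolvent hz w)).1 (Lp.memLp _)
  refine EventuallyEq.trans ?_ (fourierInv_toLp_ae (integrable_symb_mul hz w) h2)
  have : h2.toLp _ = (𝓕 (resolvent hz w) : L2) := by
    refine Lp.ext ?_
    filter_upwards [h2.coeFn_toLp, fourier_resolvent hz w] with ξ a b
    rw [a, b]
  rw [this, FourierTransform.fourierInv_fourier_eq]

/-! ### Behaviour at the poles -/

/-- The polar part of the fundamental solution and its finite part at the pole, the latter being the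
derivative of `t ↦ e^{i√z t} / (4π)` at `t = 0`. -/
lemma tendsto_green_sub (z : ℂ) :
    Tendsto (fun y : E3 => green z y - 1 / (4 * Real.pi) / (‖y‖ : ℂ)) (𝓝[≠] 0)
      (𝓝 (Complex.I * sqrtBranch z / (4 * Real.pi))) := by
  have hd : HasDerivAt (fun t : ℂ => Complex.exp (Complex.I * sqrtBranch z * t))
      (Complex.I * sqrtBranch z) 0 := by
    simpa using ((hasDerivAt_id (0 : ℂ)).const_mul (Complex.I * sqrtBranch z)).cexp
  have ht := hd.tendsto_slope_zero.div_const (4 * Real.pi : ℂ)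
  have hn : Tendsto (fun y : E3 => (‖y‖ : ℂ)) (𝓝[≠] 0) (𝓝[≠] 0) := by
    refine tendsto_nhdsWithin_iff.2 ⟨?_, ?_⟩
    · have : Continuous fun y : E3 => (‖y‖ : ℂ) := by fun_prop
      simpa using (this.tendsto 0).mono_left nhdsWithin_le_nhds
    · filter_upwards [self_mem_nhdsWithin] with y hy
      simpa using hy
  refine (ht.comp hn).congr' ?_
  filter_upwards [self_mem_nhdsWithin] with y hy
  have : (‖y‖ : ℂ) ≠ 0 := by simpa using hy
  simp only [Function.comp_apply, green, zero_add, mul_zero, Complex.exp_zero, smul_eq_mul]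
  have hpi : (Real.pi : ℂ) ≠ 0 := by exact_mod_cast Real.pi_ne_zero
  field_simp

lemma tendsto_sub_punctured (p : E3) : Tendsto (fun y => y - p) (𝓝[≠] p) (𝓝[≠] 0) := by
  refine tendsto_nhdsWithin_iff.2 ⟨?_, ?_⟩
  · have : Continuous fun y : E3 => y - p := by fun_prop
    simpa using (this.tendsto p).mono_left nhdsWithin_le_nhds
  · filter_upwards [self_mem_nhdsWithin] with y hy
    simpa [sub_eq_zero] using hy

lemma continuousAt_green {z : ℂ} {y : E3} (hy : y ≠ 0) : ContinuousAt (green z) y := by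
  unfold green
  refine ContinuousAt.div (by fun_prop) (by fun_prop) ?_
  simpa [Real.pi_ne_zero] using hy

variable {m : ℕ} {x : Fin m → E3}

/-- Near a pole, a superposition of fundamental solutions is the polar part at this pole plus a
convergent remainder. -/
lemma tendsto_sum_green_sub (hx : Function.Injective x) (z : ℂ) (a : Fin m → ℂ) (j : Fin m) :
    Tendsto (fun y => ∑ k, a k * green z (y - x k) - a j * (1 / (4 * Real.pi) / (‖y - x j‖ : ℂ)))
      (𝓝[≠] (x j)) (𝓝 ((weylMatrix x z).mulVec a j)) := by
  have h : ∀ k, Tendsto (fun y => a k * green z (y - x k) -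
      if k = j then a j * (1 / (4 * Real.pi) / (‖y - x j‖ : ℂ)) else 0)
      (𝓝[≠] (x j)) (𝓝 (weylMatrix x z j k * a k)) := by
    intro k
    by_cases hkj : k = j
    · subst hkj
      have := ((tendsto_green_sub z).comp (tendsto_sub_punctured (x k))).const_mul (a k)
      rw [mul_comm (weylMatrix x z k k)]
      simp only [if_true, weylMatrix, Matrix.of_apply, sub_self, greenTilde, mul_one, add_zero]
      refine this.congr fun y => ?_
      simp [mul_sub]
    · have hne : x j - x k ≠ 0 := sub_ne_zero.2 fun h => hkj (hx h).symm
      simp only [hkj, if_false, weylMatrix, Matrix.of_apply, greenTilde, hne, Ne.symm hkj,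
        mul_zero, zero_add, sub_zero]
      rw [mul_comm]
      have hc : ContinuousAt (fun y => green z (y - x k)) (x j) :=
        ContinuousAt.comp (f := fun y => y - x k) (continuousAt_green hne) (by fun_prop)
      exact (hc.tendsto.mono_left nhdsWithin_le_nhds).const_mul (a k)
  have := tendsto_finsetSum Finset.univ fun k _ => h k
  simp only [Finset.sum_sub_distrib, Finset.sum_ite_eq', Finset.mem_univ, if_true] at this
  exact this

lemma tendsto_norm_sub_punctured (p : E3) :
    Tendsto (fun y : E3 => (‖y - p‖ : ℂ)) (𝓝[≠] p) (𝓝 0) := by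
  have : Continuous fun y : E3 => (‖y - p‖ : ℂ) := by fun_prop
  simpa using (this.tendsto p).mono_left nhdsWithin_le_nhds

/-- If `g - ξ / |· - p|` converges at `p`, then `g |· - p|` tends to `ξ`. -/
lemma tendsto_mul_norm_of_tendsto_sub {g : E3 → ℂ} {p : E3} {ξ l : ℂ}
    (h : Tendsto (fun y => g y - ξ / (‖y - p‖ : ℂ)) (𝓝[≠] p) (𝓝 l)) :
    Tendsto (fun y => g y * (‖y - p‖ : ℂ)) (𝓝[≠] p) (𝓝 ξ) := by
  have h1 := (h.mul (tendsto_norm_sub_punctured p)).add_const ξ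
  rw [mul_zero, zero_add] at h1
  refine h1.congr' ?_
  filter_upwards [self_mem_nhdsWithin] with y hy
  have : (‖y - p‖ : ℂ) ≠ 0 := by simpa [sub_eq_zero] using hy
  field_simp
  ring

/-- The boundary values of a continuous function plus a superposition of fundamental solutions. -/
lemma tendsto_add_sum_green (hx : Function.Injective x) (z : ℂ) (a : Fin m → ℂ) {v : E3 → ℂ}
    (hv : Continuous v) (j : Fin m) :
    Tendsto (fun y => (v y + ∑ k, a k * green z (y - x k)) - a j / (4 * Real.pi) / (‖y - x j‖ : ℂ))
      (𝓝[≠] (x j)) (𝓝 (v (x j) + (weylMatrix x z).mulVec a j)) := by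
  refine (((hv.tendsto (x j)).mono_left nhdsWithin_le_nhds).add
    (tendsto_sum_green_sub hx z a j)).congr fun y => ?_
  ring

lemma continuousOn_add_sum_green (z : ℂ) (a : Fin m → ℂ) {v : E3 → ℂ} (hv : Continuous v) :
    ContinuousOn (fun y => v y + ∑ k, a k * green z (y - x k)) (Set.range x)ᶜ := by
  intro y hy
  refine ContinuousAt.continuousWithinAt (hv.continuousAt.add ?_)
  refine tendsto_finsetSum _ fun k _ => Tendsto.const_mul _ ?_
  exact ContinuousAt.comp (f := fun y => y - x k)
    (continuousAt_green (sub_ne_zero.2 fun h => hy ⟨k, h.symm⟩)) (by fun_prop)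

/-- Functions continuous off the finite set of poles that agree almost everywhere agree near each
pole. -/
lemma eventuallyEq_of_ae_eq {g g' : E3 → ℂ} (hg : ContinuousOn g (Set.range x)ᶜ)
    (hg' : ContinuousOn g' (Set.range x)ᶜ) (h : g =ᵐ[volume] g') (j : Fin m) :
    g =ᶠ[𝓝[≠] (x j)] g' := by
  have ho : IsOpen (Set.range x)ᶜ := (Set.finite_range x).isClosed.isOpen_compl
  have heq : Set.EqOn g g' (Set.range x)ᶜ :=
    Measure.eqOn_open_of_ae_eq (ae_restrict_of_ae h) ho hg hg'
  have hs : (Set.range x \ {x j})ᶜ ∈ 𝓝 (x j) :=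
    ((Set.finite_range x).subset Set.sdiff_subset).isClosed.isOpen_compl.mem_nhds (by simp)
  filter_upwards [self_mem_nhdsWithin, mem_nhdsWithin_of_mem_nhds hs] with y h1 h2
  exact heq fun h3 => h2 ⟨h3, h1⟩

/-! ### Weyl functions and gamma fields of abstract boundary triplets -/

section Abstract

variable {V : Type*} [NormedAddCommGroup V] [InnerProductSpace ℂ V] [CompleteSpace V]

lemma exists_adjoint_eq_iff {A : V →ₗ.[ℂ] V} (hA : Dense (A.domain : Set V)) (f h : V) :
    (∃ hf : f ∈ A.adjoint.domain, A.adjoint ⟨f, hf⟩ = h) ↔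
      ∀ u : A.domain, inner ℂ h (u : V) = inner ℂ f (A u) := by
  constructor
  · rintro ⟨hf, rfl⟩ u
    exact LinearPMap.adjoint_isFormalAdjoint hA ⟨f, hf⟩ u
  · intro H
    exact ⟨LinearPMap.mem_adjoint_domain_of_exists f ⟨h, H⟩, LinearPMap.adjoint_apply_eq hA _ H⟩

namespace BoundaryTriplet

variable {A : V →ₗ.[ℂ] V} {K : Type*} [NormedAddCommGroup K] [InnerProductSpace ℂ K]

lemma mem_A₀_domain (P : BoundaryTriplet A K) {f : V} :
    f ∈ P.A₀.domain ↔ ∃ h : f ∈ A.adjoint.domain, P.Γ₀ ⟨f, h⟩ = 0 := by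
  simp [A₀, LinearPMap.domRestrict_domain]

lemma A₀_apply (P : BoundaryTriplet A K) (u : P.A₀.domain) (v : A.adjoint.domain)
    (h : (u : V) = v) : P.A₀ u = A.adjoint v :=
  LinearPMap.domRestrict_apply h

/-- For `z ∈ ρ(A₀)` the restriction of `Γ₀` to `𝔑_z` is bijective: it is injective since `z` is not
an eigenvalue of `A₀`, and onto since a given preimage can be moved into `𝔑_z` by an element of
`dom A₀ = ker Γ₀`. -/
lemma exists_inverse_on_defect [FiniteDimensional ℂ K] (P : BoundaryTriplet A K) {z : ℂ}
    (hz : z ∈ resolventSet P.A₀) :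
    ∃ S : K →ₗ[ℂ] A.adjoint.domain, (∀ a, (S a : V) ∈ defectSubspace A z ∧ P.Γ₀ (S a) = a) ∧
      ∀ f : A.adjoint.domain, (f : V) ∈ defectSubspace A z → S (P.Γ₀ f) = f := by
  obtain ⟨R, hR1, hR2⟩ := hz
  -- the kernel of `L` is the defect subspace, as a submodule of `dom A*`
  let L : A.adjoint.domain →ₗ[ℂ] V := A.adjoint.toFun - z • A.adjoint.domain.subtype
  have hL : ∀ f : A.adjoint.domain, f ∈ LinearMap.ker L ↔ (f : V) ∈ defectSubspace A z := by
    intro f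
    rw [LinearMap.mem_ker]
    constructor
    · intro h
      exact ⟨f.2, sub_eq_zero.1 h⟩
    · rintro ⟨_, h⟩
      exact sub_eq_zero.2 h
  let G : LinearMap.ker L →ₗ[ℂ] K := P.Γ₀ ∘ₗ (LinearMap.ker L).subtype
  have hinj : Function.Injective G := by
    rw [← LinearMap.ker_eq_bot, LinearMap.ker_eq_bot']
    rintro ⟨f, hf⟩ h0
    have hmem : (f : V) ∈ P.A₀.domain := P.mem_A₀_domain.2 ⟨f.2, h0⟩
    have h1 := hR2 ⟨f, hmem⟩
    rw [P.A₀_apply ⟨f, hmem⟩ f rfl] at h1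
    have h2 : A.adjoint f - z • (f : V) = 0 := hf
    simp only [h2, map_zero] at h1
    exact Subtype.ext (Subtype.ext h1.symm)
  have hsurj : Function.Surjective G := by
    intro a
    obtain ⟨f, hf, -⟩ := P.surjective a 0
    obtain ⟨hu, hu1⟩ := hR1 (L f)
    obtain ⟨hu2, hu3⟩ := P.mem_A₀_domain.1 hu
    rw [P.A₀_apply _ ⟨_, hu2⟩ rfl] at hu1
    refine ⟨⟨f - ⟨_, hu2⟩, ?_⟩, ?_⟩
    · rw [LinearMap.mem_ker, map_sub]
      exact sub_eq_zero.2 hu1.symm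
    · change P.Γ₀ (f - ⟨_, hu2⟩) = a
      rw [map_sub, hu3, sub_zero, hf]
  let e := LinearEquiv.ofBijective G ⟨hinj, hsurj⟩
  refine ⟨(LinearMap.ker L).subtype ∘ₗ e.symm.toLinearMap, fun a => ⟨?_, ?_⟩, fun f hf => ?_⟩
  · exact (hL _).1 (e.symm a).2
  · exact e.apply_symm_apply a
  · have := e.symm_apply_apply ⟨f, (hL f).2 hf⟩
    exact congrArg Subtype.val this

lemma existsUnique_isWeylFunction [FiniteDimensional ℂ K] (P : BoundaryTriplet A K) :
    ∃! M : resolventSet P.A₀ → (K →L[ℂ] K), P.IsWeylFunction M := by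
  choose S hS1 hS2 using fun z : resolventSet P.A₀ => P.exists_inverse_on_defect z.2
  refine ⟨fun z => LinearMap.toContinuousLinearMap (P.Γ₁ ∘ₗ S z), fun z f hf => ?_,
    fun M hM => ?_⟩
  · simp [hS2 z f hf]
  · funext z
    ext1 a
    obtain ⟨h1, h2⟩ := hS1 z a
    have := hM z (S z a) h1
    rw [h2] at this
    simpa using this

lemma existsUnique_isGammaField [FiniteDimensional ℂ K] (P : BoundaryTriplet A K) :
    ∃! γ : resolventSet P.A₀ → (K →L[ℂ] V), P.IsGammaField γ := by
  choose S hS1 hS2 using fun z : resolventSet P.A₀ => P.exists_inverse_on_defect z.2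
  refine ⟨fun z => LinearMap.toContinuousLinearMap (A.adjoint.domain.subtype ∘ₗ S z),
    fun z => ⟨fun a => ⟨(hS1 z a).1, (S z a).2, (hS1 z a).2⟩, fun f hf => ?_⟩, fun γ hγ => ?_⟩
  · simp [hS2 z f hf]
  · funext z
    ext1 a
    obtain ⟨h1, h2⟩ := hS1 z a
    have := (hγ z).2 (S z a) h1
    rw [h2] at this
    simpa using this

end BoundaryTriplet

end Abstract

/-! ### Superpositions of fundamental solutions -/

variable {z : ℂ}

lemma greenLp_conj_conj (hz : z ∉ Complex.ofReal '' Set.Ici 0) (p : E3) :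
    greenLp (conj_notMem_nonneg (conj_notMem_nonneg hz)) p = greenLp hz p := by
  congr 1
  exact Complex.conj_conj z

/-- The superposition `∑ a_j G_z(· - x_j)` of fundamental solutions with poles at the points
`x_j`. -/
def greenSum (hz : z ∉ Complex.ofReal '' Set.Ici 0) (x : Fin m → E3) :
    EuclideanSpace ℂ (Fin m) →L[ℂ] L2 :=
  ∑ j, (EuclideanSpace.proj j : EuclideanSpace ℂ (Fin m) →L[ℂ] ℂ).smulRight (greenLp hz (x j))

lemma greenSum_apply (hz : z ∉ Complex.ofReal '' Set.Ici 0) (a : EuclideanSpace ℂ (Fin m)) :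
    greenSum hz x a = ∑ j, a j • greenLp hz (x j) := by
  simp [greenSum]

lemma greenSum_ae (hz : z ∉ Complex.ofReal '' Set.Ici 0) (a : EuclideanSpace ℂ (Fin m)) :
    greenSum hz x a =ᵐ[volume] fun y => ∑ j, a j * green z (y - x j) := by
  rw [greenSum_apply]
  have h1 := Lp.coeFn_finsetSum Finset.univ fun j => a j • greenLp hz (x j)
  have h2 : ∀ᵐ y, ∀ j, (a j • greenLp hz (x j) : L2) y = a j * green z (y - x j) := by
    rw [ae_all_iff]
    intro j
    filter_upwards [Lp.coeFn_smul (a j) (greenLp hz (x j)), greenLp_ae hz (x j)] with y h3 h4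
    rw [h3, Pi.smul_apply, h4, smul_eq_mul]
  filter_upwards [h1, h2] with y h3 h4
  rw [h3, Finset.sum_apply]
  exact Finset.sum_congr rfl fun j _ => h4 j

lemma resolvent_add_greenSum_ae (hz : z ∉ Complex.ofReal '' Set.Ici 0) {f w : L2}
    {a : EuclideanSpace ℂ (Fin m)} (h : f = resolvent hz w + greenSum hz x a) :
    f =ᵐ[volume] fun y => inner ℂ (greenLp (conj_notMem_nonneg hz) y) w +
      ∑ k, a k * green z (y - x k) := by
  rw [h]
  filter_upwards [Lp.coeFn_add (resolvent hz w) (greenSum hz x a), resolvent_ae hz w,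
    greenSum_ae hz (x := x) a] with y h1 h2 h3
  rw [h1, Pi.add_apply, h2, h3]

lemma adjoint_greenSum_apply (hz : z ∉ Complex.ofReal '' Set.Ici 0) (w : L2) (j : Fin m) :
    (greenSum hz x).adjoint w j = inner ℂ (greenLp hz (x j)) w := by
  have h1 : (greenSum hz x).adjoint w j =
      inner ℂ (EuclideanSpace.single j (1 : ℂ)) ((greenSum hz x).adjoint w) := by
    simp [EuclideanSpace.inner_single_left]
  rw [h1, ContinuousLinearMap.adjoint_inner_right, greenSum_apply]
  simp [PiLp.single_apply]

/-- Superpositions of fundamental solutions are too singular to lie in `W^{2,2}`. -/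
lemma eq_zero_of_resolvent_eq_greenSum {z' : ℂ} (hx : Function.Injective x)
    (hz : z ∉ Complex.ofReal '' Set.Ici 0) (hz' : z' ∉ Complex.ofReal '' Set.Ici 0) {w : L2}
    {a : EuclideanSpace ℂ (Fin m)} (h : resolvent hz' w = greenSum hz x a) : a = 0 := by
  have hv := continuous_inner_greenLp hz' w
  ext j
  have hae : (fun y => inner ℂ (greenLp (conj_notMem_nonneg hz') y) w +
      ∑ k, (0 : ℂ) * green z (y - x k)) =ᵐ[volume] fun y => (0 : ℂ) + ∑ k, a k * green z (y - x k) := by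
    filter_upwards [resolvent_ae hz' w, greenSum_ae hz (x := x) a] with y h1 h2
    rw [h] at h1
    rw [← h1, h2]
    simp
  have he := eventuallyEq_of_ae_eq (continuousOn_add_sum_green z _ hv)
    (continuousOn_add_sum_green z (fun k => a k) continuous_const) hae j
  have h1 := tendsto_mul_norm_of_tendsto_sub (tendsto_add_sum_green hx z (fun _ => 0) hv j)
  have h2 := tendsto_mul_norm_of_tendsto_sub
    (tendsto_add_sum_green hx z (fun k => a k) (v := fun _ => 0) continuous_const j)
  have h3 := tendsto_nhds_unique (h1.congr' (he.mono fun y hy => by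
    simp only at hy; rw [hy])) h2
  have hpi : (Real.pi : ℂ) ≠ 0 := by exact_mod_cast Real.pi_ne_zero
  simpa [hpi] using h3.symm

lemma greenSum_injective (hx : Function.Injective x) (hz : z ∉ Complex.ofReal '' Set.Ici 0) :
    Function.Injective (greenSum hz x) := by
  refine (injective_iff_map_eq_zero _).2 fun a ha => ?_
  refine eq_zero_of_resolvent_eq_greenSum hx hz hz (w := 0) ?_
  rw [map_zero, ha]

lemma adjoint_greenSum_surjective (hx : Function.Injective x)
    (hz : z ∉ Complex.ofReal '' Set.Ici 0) : Function.Surjective (greenSum hz x).adjoint := by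
  have h := (greenSum hz x).adjoint.orthogonal_range
  rw [ContinuousLinearMap.adjoint_adjoint,
    LinearMap.ker_eq_bot.2 (greenSum_injective hx hz), Submodule.orthogonal_eq_bot_iff] at h
  exact LinearMap.range_eq_top.1 h

/-- A vector orthogonal to everything that is orthogonal to the fundamental solutions is a
superposition of them, as their span is finite dimensional. -/
lemma exists_eq_greenSum (hz : z ∉ Complex.ofReal '' Set.Ici 0) {f : L2}
    (h : ∀ w : L2, (greenSum hz x).adjoint w = 0 → inner ℂ f w = 0) :
    ∃ a, f = greenSum hz x a := by
  have h1 : f ∈ ((greenSum hz x).adjoint.ker)ᗮ :=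
    (Submodule.mem_orthogonal' _ _).2 fun w hw => h w hw
  rw [ContinuousLinearMap.orthogonal_ker, ContinuousLinearMap.adjoint_adjoint,
    (Submodule.closed_of_finiteDimensional _).submodule_topologicalClosure_eq] at h1
  obtain ⟨a, ha⟩ := h1
  exact ⟨a, ha.symm⟩

/-! ### The minimal operator and its adjoint -/

/-- `u = (-Δ - z)⁻¹ (H u - z u)` for `u ∈ dom H`. -/
lemma eq_resolvent_of_mem_domain (hz : z ∉ Complex.ofReal '' Set.Ici 0)
    (u : (minimalH x).domain) :
    (u : L2) = resolvent hz (minimalH x u - z • (u : L2)) := by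
  rw [← laplacian_eq_neg_iff hz, sub_add_cancel]
  exact (minimalH_spec x u).symm

/-- For `u ∈ dom H`, the vector `(H - z̄) u` is orthogonal to the fundamental solutions, since the
pairings are the values of `u` at the poles. -/
lemma adjoint_greenSum_sub_eq_zero (hz : z ∉ Complex.ofReal '' Set.Ici 0)
    (u : (minimalH x).domain) :
    (greenSum hz x).adjoint (minimalH x u - conj z • (u : L2)) = 0 := by
  ext j
  have h := eq_resolvent_of_mem_domain (conj_notMem_nonneg hz) u
  obtain ⟨g, hg, hug, hg0⟩ := u.2.2
  have hv := continuous_inner_greenLp (conj_notMem_nonneg hz) (minimalH x u - conj z • (u : L2))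
  have hae := resolvent_ae (conj_notMem_nonneg hz) (minimalH x u - conj z • (u : L2))
  rw [← h] at hae
  have := congrFun ((hg.ae_eq_iff_eq hv (μ := volume)).1 (hug.symm.trans hae)) (x j)
  rw [hg0, greenLp_conj_conj] at this
  · rw [adjoint_greenSum_apply, ← this]
    rfl
  · exact hz

lemma resolvent_mem_minimalDomain (hz : z ∉ Complex.ofReal '' Set.Ici 0) {w : L2}
    (h : (greenSum (conj_notMem_nonneg hz) x).adjoint w = 0) :
    resolvent hz w ∈ (minimalH x).domain := by
  refine ⟨resolvent_mem_W22 hz w, _, continuous_inner_greenLp hz w, resolvent_ae hz w, fun j => ?_⟩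
  rw [← adjoint_greenSum_apply, h]
  rfl

lemma minimalH_resolvent (hz : z ∉ Complex.ofReal '' Set.Ici 0) {w : L2}
    (h : resolvent hz w ∈ (minimalH x).domain) :
    minimalH x ⟨_, h⟩ = w + z • resolvent hz w := by
  have h1 := minimalH_spec x ⟨_, h⟩
  rw [(laplacian_eq_neg_iff hz _ w).2 rfl] at h1
  exact neg_injective (coe_dist_injective h1)

lemma neg_one_notMem : (-1 : ℂ) ∉ Complex.ofReal '' Set.Ici 0 := by
  rintro ⟨t, ht, h⟩
  have : t = -1 := by exact_mod_cast h
  have ht : 0 ≤ t := ht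
  linarith

lemma greenSum_conj_neg_one :
    greenSum (conj_notMem_nonneg neg_one_notMem) x = greenSum neg_one_notMem x := by
  congr 1
  simp

lemma inner_resolvent_neg_one (v w : L2) :
    inner ℂ (resolvent neg_one_notMem v) w = inner ℂ v (resolvent neg_one_notMem w) := by
  rw [inner_resolvent]
  congr 3
  simp

/-- If `f ⊥ dom H`, then `(-Δ + 1)⁻¹ f` is a superposition of fundamental solutions and hence zero. -/
lemma dense_minimalDomain (hx : Function.Injective x) :
    Dense ((minimalH x).domain : Set L2) := by
  rw [Submodule.dense_iff_topologicalClosure_eq_top, Submodule.topologicalClosure_eq_top_iff,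
    Submodule.eq_bot_iff]
  intro f hf
  obtain ⟨a, ha⟩ := exists_eq_greenSum (x := x) neg_one_notMem
    (f := resolvent neg_one_notMem f) fun w hw => by
      rw [inner_resolvent_neg_one]
      refine (Submodule.mem_orthogonal' _ _).1 hf _ (resolvent_mem_minimalDomain _ ?_)
      rw [greenSum_conj_neg_one, hw]
  have h0 := eq_zero_of_resolvent_eq_greenSum hx _ _ ha
  have h1 := (laplacian_eq_neg_iff neg_one_notMem (resolvent neg_one_notMem f) f).2 rfl
  rw [ha, h0, map_zero, smul_zero, add_zero] at h1
  have h2 : Δ ((0 : L2) : 𝓢'(E3, ℂ)) = ((0 : L2) : 𝓢'(E3, ℂ)) := by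
    rw [coe_zero_dist, ← TemperedDistribution.laplacianCLM_apply, map_zero]
  rw [h2] at h1
  exact neg_eq_zero.1 (coe_dist_injective h1).symm

/-- The adjoint of the minimal operator: `f ∈ dom H*` with `H* f = h` if and only if
`f - (-Δ + 1)⁻¹ (h + f)` is a superposition of fundamental solutions. -/
lemma adjoint_minimalH_iff (hx : Function.Injective x) (f h : L2) :
    (∃ hf : f ∈ (minimalH x).adjoint.domain, (minimalH x).adjoint ⟨f, hf⟩ = h) ↔
      ∃ a, f = resolvent neg_one_notMem (h + f) + greenSum neg_one_notMem x a := by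
  rw [exists_adjoint_eq_iff (dense_minimalDomain hx)]
  constructor
  · intro H
    obtain ⟨a, ha⟩ := exists_eq_greenSum (x := x) neg_one_notMem
      (f := f - resolvent neg_one_notMem (h + f)) fun w hw => by
        have hmem := resolvent_mem_minimalDomain (x := x) neg_one_notMem (w := w) (by
          rw [greenSum_conj_neg_one, hw])
        have h1 := H ⟨_, hmem⟩
        rw [minimalH_resolvent, neg_one_smul, inner_add_right, inner_neg_right] at h1
        rw [inner_sub_left, inner_resolvent_neg_one, inner_add_left, h1]
        ring
    exact ⟨a, by rw [← ha, add_sub_cancel]⟩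
  · rintro ⟨a, ha⟩ u
    set w := minimalH x u + (u : L2) with hw
    have h1 := eq_resolvent_of_mem_domain neg_one_notMem u
    have h2 := adjoint_greenSum_sub_eq_zero neg_one_notMem u
    rw [map_neg, map_one] at h2
    rw [neg_one_smul, sub_neg_eq_add, ← hw] at h1 h2
    have h3 : inner ℂ f w = inner ℂ (h + f) (u : L2) := by
      conv_lhs => rw [ha]
      rw [inner_add_left, inner_resolvent_neg_one, ← h1,
        ← ContinuousLinearMap.adjoint_inner_right, h2, inner_zero_right, add_zero]
    have h4 : minimalH x u = w - u := by rw [hw]; abel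
    rw [h4, inner_sub_right, h3, inner_add_left]
    ring

lemma greenSum_mem_defectSubspace (hx : Function.Injective x)
    (hz : z ∉ Complex.ofReal '' Set.Ici 0) (a : EuclideanSpace ℂ (Fin m)) :
    greenSum hz x a ∈ defectSubspace (minimalH x) z := by
  refine (exists_adjoint_eq_iff (dense_minimalDomain hx) _ _).2 fun u => ?_
  have h := congrArg (inner ℂ a) (adjoint_greenSum_sub_eq_zero hz u)
  rw [ContinuousLinearMap.adjoint_inner_right, inner_zero_right, inner_sub_right,
    inner_smul_right, sub_eq_zero] at h
  rw [h, inner_smul_left]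

/-- `W^{2,2} ⊆ dom H*`, and `H*` acts there as `-Δ`. -/
lemma adjoint_resolvent (hx : Function.Injective x) (hz : z ∉ Complex.ofReal '' Set.Ici 0)
    (w : L2) : ∃ h : resolvent hz w ∈ (minimalH x).adjoint.domain,
      (minimalH x).adjoint ⟨_, h⟩ = w + z • resolvent hz w := by
  refine (exists_adjoint_eq_iff (dense_minimalDomain hx) _ _).2 fun u => ?_
  have h := inner_resolvent hz w (minimalH x u - conj z • (u : L2))
  rw [← eq_resolvent_of_mem_domain, inner_sub_right, inner_smul_right] at h
  rw [inner_add_left, inner_smul_left, ← h]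
  ring

/-! ### The boundary triplet -/

/-- `M(z̄) = M(z)*`; in particular the Weyl matrix at `-1` is Hermitian. -/
lemma weylMatrix_conj (hz : z ∉ Complex.ofReal '' Set.Ici 0) :
    weylMatrix x (conj z) = star (weylMatrix x z) := by
  ext j k
  have h : greenTilde (conj z) (x j - x k) = conj (greenTilde z (x k - x j)) := by
    unfold greenTilde
    rw [← neg_sub (x k), green_neg, green_conj hz]
    simp only [neg_eq_zero]
    split_ifs <;> simp
  rw [Matrix.star_apply]
  simp only [weylMatrix, Matrix.of_apply, sqrtBranch_conj hz, h, eq_comm (a := k)]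
  simp [apply_ite]

/-- The operator `f ↦ H* f + f` on `dom H*`. -/
def adjointAddOne (x : Fin m → E3) : (minimalH x).adjoint.domain →ₗ[ℂ] L2 :=
  (minimalH x).adjoint.toFun + (minimalH x).adjoint.domain.subtype

lemma adjointAddOne_apply (f : (minimalH x).adjoint.domain) :
    adjointAddOne x f = (minimalH x).adjoint f + (f : L2) := rfl

/-- The coefficients `a_j` of the fundamental solutions, for `f ∈ dom H*`. -/
lemma exists_singularPart (hx : Function.Injective x) :
    ∃ Γ : (minimalH x).adjoint.domain →ₗ[ℂ] EuclideanSpace ℂ (Fin m),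
      ∀ f : (minimalH x).adjoint.domain, (f : L2) =
        resolvent neg_one_notMem (adjointAddOne x f) + greenSum neg_one_notMem x (Γ f) := by
  obtain ⟨S, hS⟩ := (greenSum neg_one_notMem x).toLinearMap.exists_leftInverse_of_injective
    (LinearMap.ker_eq_bot.2 (greenSum_injective hx neg_one_notMem))
  refine ⟨S ∘ₗ ((minimalH x).adjoint.domain.subtype -
    (resolvent neg_one_notMem).toLinearMap ∘ₗ adjointAddOne x), fun f => ?_⟩
  obtain ⟨a, ha⟩ := (adjoint_minimalH_iff hx f _).1 ⟨f.2, rfl⟩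
  have h1 : (f : L2) - resolvent neg_one_notMem (adjointAddOne x f) =
      greenSum neg_one_notMem x a := sub_eq_iff_eq_add'.2 ha
  have h2 : S (greenSum neg_one_notMem x a) = a := LinearMap.congr_fun hS a
  have h3 : S ((f : L2) - resolvent neg_one_notMem (adjointAddOne x f)) = a := by rw [h1, h2]
  refine ha.trans (congrArg (fun b => _ + greenSum neg_one_notMem x b) ?_)
  exact h3.symm

lemma singularPart_eq (hx : Function.Injective x) {f w : L2} {a b : EuclideanSpace ℂ (Fin m)}
    (h1 : f = resolvent neg_one_notMem w + greenSum neg_one_notMem x a)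
    (h2 : f = resolvent neg_one_notMem w + greenSum neg_one_notMem x b) : a = b :=
  greenSum_injective hx neg_one_notMem (add_left_cancel (h1.symm.trans h2))

lemma exists_hasPointBoundaryMaps (hx : Function.Injective x) :
    ∃ P : BoundaryTriplet (minimalH x) (EuclideanSpace ℂ (Fin m)), HasPointBoundaryMaps x P := by
  obtain ⟨Γ, hΓ⟩ := exists_singularPart hx
  let T := greenSum neg_one_notMem x
  let R := resolvent neg_one_notMem
  let W := Matrix.toEuclideanCLM (𝕜 := ℂ) (weylMatrix x (-1))
  have hW : ∀ a b, inner ℂ a (W b) = inner ℂ (W a) b := by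
    have h : W.adjoint = W := by
      rw [← ContinuousLinearMap.star_eq_adjoint, ← map_star, ← weylMatrix_conj neg_one_notMem]
      simp [W]
    intro a b
    rw [← ContinuousLinearMap.adjoint_inner_left, h]
  refine ⟨⟨Γ, T.adjoint.toLinearMap ∘ₗ adjointAddOne x + W.toLinearMap ∘ₗ Γ, ?_, ?_⟩, ?_⟩
  · intro f g
    set p := adjointAddOne x f with hp
    set q := adjointAddOne x g with hq
    have e1 : inner ℂ (g : L2) p = inner ℂ q (R p) + inner ℂ (Γ g) (T.adjoint p) := by
      rw [hΓ g, inner_add_left, inner_resolvent_neg_one, ContinuousLinearMap.adjoint_inner_right]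
    have e2 : inner ℂ q (f : L2) = inner ℂ q (R p) + inner ℂ (T.adjoint q) (Γ f) := by
      rw [hΓ f, inner_add_right, ContinuousLinearMap.adjoint_inner_left]
    have e3 : inner ℂ (g : L2) p = inner ℂ (g : L2) ((minimalH x).adjoint f) +
        inner ℂ (g : L2) (f : L2) := by
      rw [hp, adjointAddOne_apply, inner_add_right]
    have e4 : inner ℂ q (f : L2) = inner ℂ ((minimalH x).adjoint g) (f : L2) +
        inner ℂ (g : L2) (f : L2) := by
      rw [hq, adjointAddOne_apply, inner_add_left]
    simp only [LinearMap.add_apply, LinearMap.comp_apply, ContinuousLinearMap.coe_coe,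
      inner_add_left, inner_add_right]
    rw [hW]
    linear_combination e1 - e2 - e3 + e4
  · intro a b
    obtain ⟨w, hw⟩ := adjoint_greenSum_surjective hx neg_one_notMem (b - W a)
    set f : L2 := R w + T a with hf
    obtain ⟨hmem, hadj⟩ := (adjoint_minimalH_iff hx f (w - f)).2
      ⟨a, by rw [sub_add_cancel]⟩
    have hL : adjointAddOne x ⟨f, hmem⟩ = w := by
      rw [adjointAddOne_apply, hadj, sub_add_cancel]
    have hΓf := hΓ ⟨f, hmem⟩
    rw [hL] at hΓf
    have ha := singularPart_eq hx hΓf hf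
    refine ⟨⟨f, hmem⟩, ha, ?_⟩
    simp only [LinearMap.add_apply, LinearMap.comp_apply, ContinuousLinearMap.coe_coe]
    rw [hL, ha, hw, sub_add_cancel]
  · intro f
    have hv := continuous_inner_greenLp neg_one_notMem (adjointAddOne x f)
    refine ⟨fun y => inner ℂ (greenLp (conj_notMem_nonneg neg_one_notMem) y) (adjointAddOne x f) +
      ∑ k, Γ f k * green (-1) (y - x k), continuousOn_add_sum_green _ _ hv,
      resolvent_add_greenSum_ae neg_one_notMem (hΓ f), fun j => ?_⟩
    · have h := tendsto_add_sum_green hx (-1) (fun k => Γ f k) hv j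
      refine ⟨_, tendsto_mul_norm_of_tendsto_sub h, ?_, ?_⟩
      · have hpi : (Real.pi : ℂ) ≠ 0 := by exact_mod_cast Real.pi_ne_zero
        field_simp
      · rw [← adjoint_greenSum_apply, greenSum_conj_neg_one] at h
        exact h

/-- The boundary values are determined by any decomposition of `f` into a continuous function and
a superposition of fundamental solutions. -/
lemma HasPointBoundaryMaps.boundary_values (hx : Function.Injective x)
    {P : BoundaryTriplet (minimalH x) (EuclideanSpace ℂ (Fin m))} (hP : HasPointBoundaryMaps x P)
    (z : ℂ) (f : (minimalH x).adjoint.domain) {v : E3 → ℂ} (hv : Continuous v)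
    (a : EuclideanSpace ℂ (Fin m))
    (h : (f : L2) =ᵐ[volume] fun y => v y + ∑ k, a k * green z (y - x k)) :
    P.Γ₀ f = a ∧ ∀ j, P.Γ₁ f j = v (x j) + (weylMatrix x z).mulVec a j := by
  obtain ⟨g, hg, hfg, hlim⟩ := hP f
  have key : ∀ j, P.Γ₀ f j = a j ∧ P.Γ₁ f j = v (x j) + (weylMatrix x z).mulVec a j := by
    intro j
    obtain ⟨ξ, h1, h2, h3⟩ := hlim j
    have he := eventuallyEq_of_ae_eq (continuousOn_add_sum_green z (fun k => a k) hv) hg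
      (h.symm.trans hfg) j
    have h4 := tendsto_add_sum_green hx z (fun k => a k) hv j
    have hξ : ξ = a j / (4 * Real.pi) := by
      refine tendsto_nhds_unique h1 ((tendsto_mul_norm_of_tendsto_sub h4).congr' ?_)
      filter_upwards [he] with y hy
      rw [hy]
    have hpi : (Real.pi : ℂ) ≠ 0 := by exact_mod_cast Real.pi_ne_zero
    refine ⟨by rw [h2, hξ]; field_simp, ?_⟩
    refine tendsto_nhds_unique h3 (h4.congr' ?_)
    filter_upwards [he] with y hy
    rw [hy, hξ]
  exact ⟨by ext j; exact (key j).1, fun j => (key j).2⟩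

lemma existsUnique_hasPointBoundaryMaps (hx : Function.Injective x) :
    ∃! P : BoundaryTriplet (minimalH x) (EuclideanSpace ℂ (Fin m)),
      HasPointBoundaryMaps x P := by
  obtain ⟨P, hP⟩ := exists_hasPointBoundaryMaps hx
  refine ⟨P, hP, fun Q hQ => ?_⟩
  obtain ⟨Γ, hΓ⟩ := exists_singularPart hx
  have key : ∀ f : (minimalH x).adjoint.domain, Q.Γ₀ f = P.Γ₀ f ∧ ∀ j, Q.Γ₁ f j = P.Γ₁ f j := by
    intro f
    have h := resolvent_add_greenSum_ae neg_one_notMem (hΓ f)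
    have hv := continuous_inner_greenLp neg_one_notMem (adjointAddOne x f)
    have h1 := hP.boundary_values hx (-1) f hv _ h
    have h2 := hQ.boundary_values hx (-1) f hv _ h
    exact ⟨h2.1.trans h1.1.symm, fun j => (h2.2 j).trans (h1.2 j).symm⟩
  refine BoundaryTriplet.ext ?_ ?_
  · exact LinearMap.ext fun f => (key f).1
  · refine LinearMap.ext fun f => ?_
    ext j
    exact (key f).2 j

lemma HasPointBoundaryMaps.boundary_values_greenSum (hx : Function.Injective x)
    {P : BoundaryTriplet (minimalH x) (EuclideanSpace ℂ (Fin m))} (hP : HasPointBoundaryMaps x P)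
    (hz : z ∉ Complex.ofReal '' Set.Ici 0) (a : EuclideanSpace ℂ (Fin m))
    (h : greenSum hz x a ∈ (minimalH x).adjoint.domain) :
    P.Γ₀ ⟨_, h⟩ = a ∧ P.Γ₁ ⟨_, h⟩ = Matrix.toEuclideanCLM (𝕜 := ℂ) (weylMatrix x z) a := by
  obtain ⟨h1, h2⟩ := hP.boundary_values hx z ⟨_, h⟩ (v := fun _ => 0) continuous_const a (by
    simpa using greenSum_ae hz (x := x) a)
  refine ⟨h1, ?_⟩
  ext j
  rw [h2 j, zero_add, Matrix.ofLp_toEuclideanCLM]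

/-- The operator `H_0 = H* ↾ ker Γ₀` is the free Laplacian on `W^{2,2}(ℝ³)`, so its resolvent is
the free one. -/
lemma HasPointBoundaryMaps.mem_resolventSet (hx : Function.Injective x)
    {P : BoundaryTriplet (minimalH x) (EuclideanSpace ℂ (Fin m))} (hP : HasPointBoundaryMaps x P)
    (hz : z ∉ Complex.ofReal '' Set.Ici 0) : z ∈ resolventSet P.A₀ := by
  refine ⟨resolvent hz, fun y => ?_, fun u => ?_⟩
  · obtain ⟨h1, h2⟩ := adjoint_resolvent hx hz y
    have h3 := (hP.boundary_values hx z ⟨_, h1⟩ (continuous_inner_greenLp hz y) 0 (by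
      simpa using resolvent_ae hz y)).1
    refine ⟨P.mem_A₀_domain.2 ⟨h1, h3⟩, ?_⟩
    rw [P.A₀_apply _ ⟨_, h1⟩ rfl, h2, add_sub_cancel_right]
  · obtain ⟨h1, h2⟩ := P.mem_A₀_domain.1 u.2
    rw [P.A₀_apply u ⟨_, h1⟩ rfl]
    set f : (minimalH x).adjoint.domain := ⟨u, h1⟩ with hf
    obtain ⟨a, ha⟩ := (adjoint_minimalH_iff hx f _).1 ⟨f.2, rfl⟩
    set w := (minimalH x).adjoint f + (f : L2) with hw
    have h3 := (hP.boundary_values hx (-1) f (continuous_inner_greenLp neg_one_notMem w) a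
      (resolvent_add_greenSum_ae neg_one_notMem ha)).1
    have ha0 : a = 0 := h3.symm.trans h2
    have h4 : (f : L2) = resolvent neg_one_notMem w := by
      rw [ha0, map_zero, add_zero] at ha
      exact ha
    rw [← laplacian_eq_neg_iff, hw, neg_one_smul, add_neg_cancel_right] at h4
    symm
    rw [← laplacian_eq_neg_iff, sub_add_cancel]
    exact h4

end PointInteraction

end

theorem proposition4p3 {m : ℕ} (x : Fin m → PointInteraction.E3) (hx : Function.Injective x) :
    Dense ((PointInteraction.minimalH x).domain : Set PointInteraction.L2) ∧
    (∃! P : PointInteraction.BoundaryTriplet (PointInteraction.minimalH x)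
        (EuclideanSpace ℂ (Fin m)), PointInteraction.HasPointBoundaryMaps x P) ∧
    ∀ P : PointInteraction.BoundaryTriplet (PointInteraction.minimalH x)
        (EuclideanSpace ℂ (Fin m)),
      PointInteraction.HasPointBoundaryMaps x P →
      (∀ z : ℂ, z ∉ Complex.ofReal '' Set.Ici 0 → z ∈ PointInteraction.resolventSet P.A₀) ∧
      (∃! M : PointInteraction.resolventSet P.A₀ →
          (EuclideanSpace ℂ (Fin m) →L[ℂ] EuclideanSpace ℂ (Fin m)), P.IsWeylFunction M) ∧
      (∃! γ : PointInteraction.resolventSet P.A₀ →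
          (EuclideanSpace ℂ (Fin m) →L[ℂ] PointInteraction.L2), P.IsGammaField γ) ∧
      (∀ M : PointInteraction.resolventSet P.A₀ →
          (EuclideanSpace ℂ (Fin m) →L[ℂ] EuclideanSpace ℂ (Fin m)), P.IsWeylFunction M →
        ∀ z : PointInteraction.resolventSet P.A₀, (z : ℂ) ∉ Complex.ofReal '' Set.Ici 0 →
          M z = Matrix.toEuclideanCLM (𝕜 := ℂ) (PointInteraction.weylMatrix x z)) ∧
      (∀ γ : PointInteraction.resolventSet P.A₀ →
          (EuclideanSpace ℂ (Fin m) →L[ℂ] PointInteraction.L2), P.IsGammaField γ →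
        ∀ z : PointInteraction.resolventSet P.A₀, (z : ℂ) ∉ Complex.ofReal '' Set.Ici 0 →
          ∀ a : EuclideanSpace ℂ (Fin m),
            γ z a =ᵐ[MeasureTheory.volume]
              fun y => ∑ j, a j * PointInteraction.green z (y - x j)) := by
  refine ⟨PointInteraction.dense_minimalDomain hx,
    PointInteraction.existsUnique_hasPointBoundaryMaps hx, fun P hP =>
    ⟨fun z hz => hP.mem_resolventSet hx hz, P.existsUnique_isWeylFunction,
      P.existsUnique_isGammaField, fun M hM z hz => ?_, fun γ hγ z hz a => ?_⟩⟩
  · ext1 a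
    have hN := PointInteraction.greenSum_mem_defectSubspace hx hz a
    obtain ⟨h0, h1⟩ := hP.boundary_values_greenSum hx hz a hN.1
    have h := hM z ⟨_, hN.1⟩ hN
    rwa [h0, h1] at h
  · have hN := PointInteraction.greenSum_mem_defectSubspace hx hz a
    have h := (hγ z).2 ⟨_, hN.1⟩ hN
    rw [(hP.boundary_values_greenSum hx hz a hN.1).1] at h
    rw [h]
    exact PointInteraction.greenSum_ae hz a
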